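/- Let $m\ge 1$ and $2m<n$, put $\eta=m/n$, and let $\mathbf H_1,\mathbf H_2$ be random $m\times n$ matrices whose entries, taken together, are i.i.d. circularly symmetric complex Gaussian with zero mean and unit variance. Put $\mathbf H=\begin{pmatrix}\mathbf H_1\\ \mathbf H_2\end{pmatrix}$ and $\mathbf B=\mathrm{diag}(\mathbf I_m,\mathbf O_{(n-2m)\times(n-2m)},\mathbf I_m)$. A GSVD of two $m\times n$ matrices $\mathbf H_1,\mathbf H_2$ consists of unitary $m\times m$ matrices $\mathbf U,\mathbf V$ and a nonsingular $n\times n$ matrix $\mathbf Q$ with $\mathbf U\mathbf H_1\mathbf Q=(\mathbf I_m\ \ \mathbf O)$ and $\mathbf V\mathbf H_2\mathbf Q=(\mathbf O\ \ \mathbf I_m)$. Zha's construction produces one as follows. Take a singular value decomposition $\mathbf V\mathbf H_2\mathbf V_2=(\mathbf O\ \ \mathrm{diag}(z_1,\dots,z_m))$ with $z_1\ge\dots\ge z_m>0$, and set $\mathbf Q_1=\mathbf V_2\,\mathrm{diag}(\mathbf I_{n-m},\mathrm{diag}(z_1,\dots,z_m)^{-1})$ and $\mathbf H_1\mathbf Q_1=(\mathbf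 H_{11}'\ \ \mathbf H_{12}')$ with $\mathbf H_{11}'$ of size $m\times(n-m)$. Take a singular value decomposition $\mathbf U\mathbf H_{11}'\mathbf V_{11}=(\mathrm{diag}(t_1,\dots,t_m)\ \ \mathbf O)$ with $t_1\ge\dots\ge t_m>0$, and set $\mathbf Q_2=\mathrm{diag}(\mathbf V_{11},\mathbf I_m)\,\mathrm{diag}(\mathrm{diag}(t_1,\dots,t_m)^{-1},\mathbf I_{n-m})$, $\mathbf Q_3=\begin{pmatrix}\mathbf I_{n-m}&\begin{pmatrix}-\mathbf U\mathbf H_{12}'\\ \mathbf O\end{pmatrix}\\ \mathbf O&\mathbf I_m\end{pmatrix}$, and $\mathbf Q=\mathbf Q_1\mathbf Q_2\mathbf Q_3$. Then: (a) Whenever $(\mathbf U,\mathbf V,\mathbf Q)$ arises in this way from (arbitrary fixed) $m\times n$ matrices $\mathbf H_1,\mathbf H_2$, it is a GSVD of them, $\mathbf H\mathbf H^H$ is invertible, and $\mathrm{trace}(\mathbf Q\mathbf B\mathbf Q^H)=\mathrm{trace}((\mathbf H\mathbf H^H)^{-1})$. (b) For the Gaussian matrices $\mathbf H_1,\mathbf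 H_2$ the construction can almost surely be carried out. If $\mathbf Q$ is a random $n\times n$ matrix that almost surely arises in this way from $\mathbf H_1,\mathbf H_2$, and $\mathbf s$ is a random signal vector in $\mathbb C^n$ with square-integrable entries, independent of $\mathbf Q$, with $\mathcal E\{\mathbf s\mathbf s^H\}=\mathbf B$, then, with all expectations finite, $$t^2:=\mathcal E\{\mathrm{trace}(\mathbf Q\mathbf s\mathbf s^H\mathbf Q^H)\}=\mathcal E\{\mathrm{trace}(\mathbf Q\mathbf B\mathbf Q^H)\}=\mathcal E\{\mathrm{trace}((\mathbf H\mathbf H^H)^{-1})\}=\frac{1}{1/(2\eta)-1}.$$ -/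

import Mathlib

open MeasureTheory ProbabilityTheory Matrix

/-- The standard circularly symmetric complex Gaussian law (mean `0`, variance `E|x|² = 1`):
real and imaginary parts are independent real Gaussians of variance `1/2`. -/
noncomputable def stdComplexGaussian : Measure ℂ :=
  ((gaussianReal 0 (1 / 2)).prod (gaussianReal 0 (1 / 2))).map
    Complex.measurableEquivRealProd.symm

/-- The `2m × n` matrix with `H₁` on top of `H₂`. -/
def stacked {m n : ℕ} (H₁ H₂ : Matrix (Fin m) (Fin n) ℂ) :
    Matrix (Fin m ⊕ Fin m) (Fin n) ℂ :=
  fromRows H₁ H₂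

/-- All entries of the random matrices `H₁` and `H₂`, taken together, are independent standard
complex Gaussian random variables. -/
structure IsGaussianPair {Ω : Type*} [MeasurableSpace Ω] (μ : Measure Ω) {m n : ℕ}
    (H₁ H₂ : Ω → Matrix (Fin m) (Fin n) ℂ) : Prop where
  law : ∀ (i : Fin m ⊕ Fin m) (j : Fin n),
    HasLaw (fun ω => stacked (H₁ ω) (H₂ ω) i j) stdComplexGaussian μ
  indep : iIndepFun
    (fun (p : (Fin m ⊕ Fin m) × Fin n) (ω : Ω) => stacked (H₁ ω) (H₂ ω) p.1 p.2) μ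

/-- Index type for `n` columns cut into consecutive blocks of sizes `m`, `n - 2m`, `m`.
The left summand indexes the first `n - m` columns. -/
abbrev Blk (m n : ℕ) : Type := (Fin m ⊕ Fin (n - 2 * m)) ⊕ Fin m

/-- The order-preserving identification of the block indices with `Fin n`. -/
def blk {m n : ℕ} (h : 2 * m < n) : Blk m n ≃ Fin n :=
  ((Equiv.sumCongr finSumFinEquiv (Equiv.refl (Fin m))).trans finSumFinEquiv).trans
    (finCongr (by omega))

/-- An `m × n` matrix given by its column blocks, with ordinary column indices. -/
def ofCols {m n : ℕ} (h : 2 * m < n) (A : Matrix (Fin m) (Blk m n) ℂ) :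
    Matrix (Fin m) (Fin n) ℂ :=
  A.submatrix id (blk h).symm

/-- An `n × n` matrix given by its blocks, with ordinary indices. -/
def ofBlks {m n : ℕ} (h : 2 * m < n) (A : Matrix (Blk m n) (Blk m n) ℂ) :
    Matrix (Fin n) (Fin n) ℂ :=
  A.submatrix (blk h).symm (blk h).symm

/-- The first `n - m` columns of an `m × n` matrix. -/
def firstCols {m n : ℕ} (h : 2 * m < n) (A : Matrix (Fin m) (Fin n) ℂ) :
    Matrix (Fin m) (Fin m ⊕ Fin (n - 2 * m)) ℂ :=
  A.submatrix id (fun j => blk h (Sum.inl j))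

/-- The last `m` columns of an `m × n` matrix. -/
def lastCols {m n : ℕ} (h : 2 * m < n) (A : Matrix (Fin m) (Fin n) ℂ) :
    Matrix (Fin m) (Fin m) ℂ :=
  A.submatrix id (fun j => blk h (Sum.inr j))

/-- The `k × k` diagonal matrix of a real vector, with complex entries. -/
noncomputable def rdiag {k : ℕ} (z : Fin k → ℝ) : Matrix (Fin k) (Fin k) ℂ :=
  diagonal (fun i => (z i : ℂ))

/-- `Σ₁ = (I_m  O)`. -/
def sigmaOne {m n : ℕ} (h : 2 * m < n) : Matrix (Fin m) (Fin n) ℂ :=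
  ofCols h (fromCols (fromCols 1 0) 0)

/-- `Σ₂ = (O  I_m)`. -/
def sigmaTwo {m n : ℕ} (h : 2 * m < n) : Matrix (Fin m) (Fin n) ℂ :=
  ofCols h (fromCols 0 1)

/-- `B = diag(I_m, O, I_m)`. -/
def matB {m n : ℕ} (h : 2 * m < n) : Matrix (Fin n) (Fin n) ℂ :=
  ofBlks h (fromBlocks (fromBlocks 1 0 0 0) 0 0 1)

/-- `(U, V, Q)` is a generalized singular value decomposition of the `m × n` matrices `H₁`, `H₂`,
in the case `2m < n`. -/
structure IsGSVD {m n : ℕ} (h : 2 * m < n) (H₁ H₂ : Matrix (Fin m) (Fin n) ℂ)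
    (U V : Matrix (Fin m) (Fin m) ℂ) (Q : Matrix (Fin n) (Fin n) ℂ) : Prop where
  unitary_left : U ∈ unitaryGroup (Fin m) ℂ
  unitary_right : V ∈ unitaryGroup (Fin m) ℂ
  nonsingular : IsUnit Q.det
  eq_left : U * H₁ * Q = sigmaOne h
  eq_right : V * H₂ * Q = sigmaTwo h

/-- The first factor of `Q`: `V₂ diag(I_{n-m}, diag(z)⁻¹)`. -/
noncomputable def zhaQOne {m n : ℕ} (h : 2 * m < n) (V₂ : Matrix (Fin n) (Fin n) ℂ)
    (z : Fin m → ℝ) : Matrix (Fin n) (Fin n) ℂ :=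
  V₂ * ofBlks h (fromBlocks 1 0 0 (rdiag z)⁻¹)

/-- The second factor of `Q`: `diag(V₁₁, I_m) diag(diag(t)⁻¹, I_{n-m})`. -/
noncomputable def zhaQTwo {m n : ℕ} (h : 2 * m < n)
    (V₁₁ : Matrix (Fin m ⊕ Fin (n - 2 * m)) (Fin m ⊕ Fin (n - 2 * m)) ℂ)
    (t : Fin m → ℝ) : Matrix (Fin n) (Fin n) ℂ :=
  ofBlks h (fromBlocks V₁₁ 0 0 1) *
    ofBlks h (fromBlocks (fromBlocks (rdiag t)⁻¹ 0 0 1) 0 0 1)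

/-- The third factor of `Q`: the block unipotent matrix with upper right block `(-X; O)`. -/
def zhaQThree {m n : ℕ} (h : 2 * m < n) (X : Matrix (Fin m) (Fin m) ℂ) :
    Matrix (Fin n) (Fin n) ℂ :=
  ofBlks h (fromBlocks 1 (fromRows (-X) 0) 0 1)

/-- `(U, V, Q)` is produced from `H₁`, `H₂` by Zha's construction for `2m < n`: take a singular
value decomposition `V H₂ V₂ = (O  diag(z))`, put `Q₁ = V₂ diag(I, diag(z)⁻¹)` and
`H₁ Q₁ = (H₁₁'  H₁₂')`, take a singular value decomposition `U H₁₁' V₁₁ = (diag(t)  O)`, and let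
`Q = Q₁ Q₂ Q₃`. -/
def IsZhaGSVD {m n : ℕ} (h : 2 * m < n) (H₁ H₂ : Matrix (Fin m) (Fin n) ℂ)
    (U V : Matrix (Fin m) (Fin m) ℂ) (Q : Matrix (Fin n) (Fin n) ℂ) : Prop :=
  ∃ (V₂ : Matrix (Fin n) (Fin n) ℂ) (z : Fin m → ℝ)
    (V₁₁ : Matrix (Fin m ⊕ Fin (n - 2 * m)) (Fin m ⊕ Fin (n - 2 * m)) ℂ) (t : Fin m → ℝ),
    V ∈ unitaryGroup (Fin m) ℂ ∧ V₂ ∈ unitaryGroup (Fin n) ℂ ∧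
    Antitone z ∧ (∀ i, 0 < z i) ∧
    V * H₂ * V₂ = ofCols h (fromCols 0 (rdiag z)) ∧
    U ∈ unitaryGroup (Fin m) ℂ ∧ V₁₁ ∈ unitaryGroup (Fin m ⊕ Fin (n - 2 * m)) ℂ ∧
    Antitone t ∧ (∀ i, 0 < t i) ∧
    U * firstCols h (H₁ * zhaQOne h V₂ z) * V₁₁ = fromCols (rdiag t) 0 ∧
    Q = zhaQOne h V₂ z * zhaQTwo h V₁₁ t *
      zhaQThree h (U * lastCols h (H₁ * zhaQOne h V₂ z))

/-- The quantity `tr(Q s sᴴ Qᴴ)`, whose expectation is the squared power normalization factor. -/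
noncomputable def txPower {n : ℕ} (Q : Matrix (Fin n) (Fin n) ℂ) (s : Fin n → ℂ) : ℂ :=
  trace (Q * vecMulVec s (star s) * Qᴴ)

/-! Deterministic half. Let `S` stack `sigmaOne` over `sigmaTwo` and let `D = diag(U, V)`. A GSVD
says `D H Q = S`, where `S Sᴴ = 1` and `Sᴴ S = B`. Hence `H Hᴴ = Dᴴ S (Qᴴ Q)⁻¹ Sᴴ D`, and if `Qᴴ Q`
commutes with `B`, the inverse of this is `Dᴴ S (Qᴴ Q) Sᴴ D`, whose trace is `tr(Q B Qᴴ)`. A general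
GSVD need not satisfy this commutation. Zha's does: there `Q = W L` with `W` unitary and `L` not
coupling the middle block to the outer ones (`IsZhaGSVD.isGSVD`).

Probabilistic half. The `i`-th diagonal entry of `(H Hᴴ)⁻¹` is `1/d²`, where `d` is the distance
from row `i` to the span of the other rows (`inv_gram_apply_self`). With the other `k = 2m - 1` rows
fixed, a linear change of variables gives `E exp(-t d²) = (1 + t)^{-(n-k)}`. Integrating over `t >
0` gives `E[1/d²] = 1/(n - k - 1) = 1/(n - 2m)`. The `2m` diagonal entries sum to `2m/(n - 2m) =
1/(1/(2η) - 1)`.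

The signal enters only through its second moments. Its components at the zeros of `B` vanish almost
surely, and the remaining columns of `Q` are square integrable because `tr(Q B Qᴴ)` is integrable
(`integral_txPower`). -/

section Blocks

/-! ### Block matrix algebra. -/

variable {m n : ℕ} (h : 2 * m < n)

theorem ofBlks_mul (A B : Matrix (Blk m n) (Blk m n) ℂ) :
    ofBlks h A * ofBlks h B = ofBlks h (A * B) :=
  submatrix_mul_equiv _ _ _ _ _

theorem ofCols_mul_ofBlks (A : Matrix (Fin m) (Blk m n) ℂ) (B : Matrix (Blk m n) (Blk m n) ℂ) :
    ofCols h A * ofBlks h B = ofCols h (A * B) :=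
  submatrix_mul_equiv _ _ _ _ _

theorem mul_ofCols (A : Matrix (Fin m) (Fin m) ℂ) (B : Matrix (Fin m) (Blk m n) ℂ) :
    A * ofCols h B = ofCols h (A * B) := rfl

theorem ofBlks_conjTranspose (A : Matrix (Blk m n) (Blk m n) ℂ) :
    (ofBlks h A)ᴴ = ofBlks h Aᴴ := rfl

theorem ofBlks_one : ofBlks h (1 : Matrix (Blk m n) (Blk m n) ℂ) = 1 :=
  submatrix_one_equiv _

theorem det_ofBlks (A : Matrix (Blk m n) (Blk m n) ℂ) : (ofBlks h A).det = A.det :=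
  det_submatrix_equiv_self _ _

theorem ofCols_firstCols_lastCols (A : Matrix (Fin m) (Fin n) ℂ) :
    ofCols h (fromCols (firstCols h A) (lastCols h A)) = A := by
  ext i j
  obtain ⟨j, rfl⟩ := (blk h).surjective j
  rcases j with j | j <;> simp [ofCols, firstCols, lastCols]

theorem matB_conjTranspose : (matB h)ᴴ = matB h := by
  rw [matB, ofBlks_conjTranspose]
  simp [fromBlocks_conjTranspose]

theorem rdiag_conjTranspose {k : ℕ} (z : Fin k → ℝ) : (rdiag z)ᴴ = rdiag z := by
  simp only [rdiag, diagonal_conjTranspose]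
  congr 1
  ext i
  simp

theorem isUnit_det_rdiag {k : ℕ} {z : Fin k → ℝ} (hz : ∀ i, 0 < z i) :
    IsUnit (rdiag z).det := by
  rw [rdiag, det_diagonal, isUnit_iff_ne_zero, Finset.prod_ne_zero_iff]
  exact fun i _ => by exact_mod_cast (hz i).ne'

theorem isUnit_det_of_mem_unitaryGroup {ι : Type*} [Fintype ι] [DecidableEq ι]
    {U : Matrix ι ι ℂ} (hU : U ∈ unitaryGroup ι ℂ) : IsUnit U.det :=
  (isUnit_iff_isUnit_det U).1 (IsUnit.of_mul_eq_one _ (mem_unitaryGroup_iff.1 hU))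

theorem sigma_mul_conjTranspose :
    stacked (sigmaOne h) (sigmaTwo h) * (stacked (sigmaOne h) (sigmaTwo h))ᴴ = 1 := by
  have e : stacked (sigmaOne h) (sigmaTwo h) =
      (fromRows (fromCols (fromCols 1 0) 0) (fromCols 0 1)).submatrix id (blk h).symm := by
    ext (i | i) j <;> rfl
  rw [e, conjTranspose_submatrix, submatrix_mul_equiv, conjTranspose_fromRows_eq_fromCols_conjTranspose,
    fromRows_mul_fromCols]
  simp [conjTranspose_fromCols_eq_fromRows_conjTranspose, fromCols_mul_fromRows]

theorem sigma_conjTranspose_mul :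
    (stacked (sigmaOne h) (sigmaTwo h))ᴴ * stacked (sigmaOne h) (sigmaTwo h) = matB h := by
  have e : stacked (sigmaOne h) (sigmaTwo h) =
      (fromRows (fromCols (fromCols 1 0) 0) (fromCols 0 1)).submatrix id (blk h).symm := by
    ext (i | i) j <;> rfl
  rw [e, conjTranspose_submatrix, ← submatrix_mul _ _ _ _ _ Function.bijective_id,
    conjTranspose_fromRows_eq_fromCols_conjTranspose, fromCols_mul_fromRows, matB, ofBlks]
  congr 1
  simp [conjTranspose_fromCols_eq_fromRows_conjTranspose, mul_fromCols]
  ext ((i | i) | i) ((j | j) | j) <;> simp [one_apply]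

end Blocks

/-! ### The trace identity for Zha's GSVD. -/

/-- If a GSVD `(U, V, Q)` is such that `Qᴴ Q` commutes with `B`, then
`Q B Qᴴ` has the same trace as the inverse Gram matrix. -/
theorem IsGSVD.trace_eq_of_commute {m n : ℕ} {h : 2 * m < n} {A₁ A₂ : Matrix (Fin m) (Fin n) ℂ}
    {U V : Matrix (Fin m) (Fin m) ℂ} {Q : Matrix (Fin n) (Fin n) ℂ}
    (hG : IsGSVD h A₁ A₂ U V Q) (hc : matB h * (Qᴴ * Q) = Qᴴ * Q * matB h) :
    IsUnit (stacked A₁ A₂ * (stacked A₁ A₂)ᴴ).det ∧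
      trace (Q * matB h * Qᴴ) = trace ((stacked A₁ A₂ * (stacked A₁ A₂)ᴴ)⁻¹) := by
  set S := stacked (sigmaOne h) (sigmaTwo h) with hS
  set H := stacked A₁ A₂ with hH
  set D : Matrix (Fin m ⊕ Fin m) (Fin m ⊕ Fin m) ℂ := fromBlocks U 0 0 V with hD
  have hU := mem_unitaryGroup_iff.1 hG.unitary_left
  have hV := mem_unitaryGroup_iff.1 hG.unitary_right
  rw [star_eq_conjTranspose] at hU hV
  have hDD : D * Dᴴ = 1 := by
    simp [hD, fromBlocks_conjTranspose, fromBlocks_multiply, hU, hV]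
  have hDD' : Dᴴ * D = 1 := mul_eq_one_comm.1 hDD
  have hSS : S * Sᴴ = 1 := sigma_mul_conjTranspose h
  have hSB : Sᴴ * S = matB h := sigma_conjTranspose_mul h
  have hDHQ : D * H * Q = S := by
    simp only [hD, hH, stacked, hS, fromBlocks_mul_fromRows, Matrix.zero_mul, add_zero, zero_add,
      fromRows_mul, hG.eq_left, hG.eq_right]
  have hQ := hG.nonsingular
  have hHe : H = Dᴴ * S * Q⁻¹ := by
    rw [← hDHQ, Matrix.mul_assoc, Matrix.mul_nonsing_inv_cancel_right _ _ hQ, ← Matrix.mul_assoc,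
      hDD', Matrix.one_mul]
  have hQ' : IsUnit Qᴴ.det := by rw [det_conjTranspose]; exact hQ.star
  have hinv : (H * Hᴴ) * (Dᴴ * S * (Qᴴ * Q) * Sᴴ * D) = 1 := by
    calc (H * Hᴴ) * (Dᴴ * S * (Qᴴ * Q) * Sᴴ * D)
        = Dᴴ * S * Q⁻¹ * (Qᴴ)⁻¹ * Sᴴ * (D * Dᴴ) * S * (Qᴴ * Q) * Sᴴ * D := by
          rw [hHe]
          simp only [conjTranspose_mul, conjTranspose_conjTranspose, conjTranspose_nonsing_inv,
            Matrix.mul_assoc]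
      _ = Dᴴ * S * Q⁻¹ * (Qᴴ)⁻¹ * ((Sᴴ * S) * (Qᴴ * Q)) * Sᴴ * D := by
          rw [hDD]; simp only [Matrix.mul_assoc, Matrix.one_mul]
      -- The only use of commutation: moving `Sᴴ S = B` to the right of `Qᴴ Q` lets the inverses
      -- cancel.
      _ = Dᴴ * S * (Q⁻¹ * ((Qᴴ)⁻¹ * Qᴴ) * Q) * (Sᴴ * S) * Sᴴ * D := by
          rw [hSB, hc]; simp only [Matrix.mul_assoc]
      _ = Dᴴ * (S * Sᴴ) * (S * Sᴴ) * D := by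
          rw [Matrix.nonsing_inv_mul _ hQ', Matrix.mul_one, Matrix.nonsing_inv_mul _ hQ]
          simp only [Matrix.mul_assoc, Matrix.one_mul]
      _ = 1 := by rw [hSS]; simp [hDD']
  refine ⟨(isUnit_iff_isUnit_det _).1 (IsUnit.of_mul_eq_one _ hinv), ?_⟩
  calc trace (Q * matB h * Qᴴ) = trace ((Qᴴ * Q * Sᴴ) * S) := by
        rw [trace_mul_comm, ← Matrix.mul_assoc, ← hSB, ← Matrix.mul_assoc]
    _ = trace (S * (Qᴴ * Q * Sᴴ) * (D * Dᴴ)) := by rw [trace_mul_comm, hDD, Matrix.mul_one]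
    _ = trace (Dᴴ * S * (Qᴴ * Q) * Sᴴ * D) := by
        rw [← Matrix.mul_assoc, trace_mul_comm]; simp only [← Matrix.mul_assoc]
    _ = _ := by rw [Matrix.inv_eq_right_inv hinv]

theorem IsZhaGSVD.isGSVD {m n : ℕ} {h : 2 * m < n} {A₁ A₂ : Matrix (Fin m) (Fin n) ℂ}
    {U V : Matrix (Fin m) (Fin m) ℂ} {Q : Matrix (Fin n) (Fin n) ℂ}
    (hZ : IsZhaGSVD h A₁ A₂ U V Q) :
    IsGSVD h A₁ A₂ U V Q ∧ matB h * (Qᴴ * Q) = Qᴴ * Q * matB h := by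
  obtain ⟨V₂, z, V₁₁, t, hV, hV₂, -, hz, hVA, hU, hV₁₁, -, ht, hUA, rfl⟩ := hZ
  have hzu := isUnit_det_rdiag hz
  have htu := isUnit_det_rdiag ht
  set M := firstCols h (A₁ * zhaQOne h V₂ z)
  set N := lastCols h (A₁ * zhaQOne h V₂ z)
  have hMN : A₁ * zhaQOne h V₂ z = ofCols h (fromCols M N) :=
    (ofCols_firstCols_lastCols h _).symm
  have h2 : V * A₂ * zhaQOne h V₂ z = ofCols h (fromCols 0 1) := by
    rw [zhaQOne, ← Matrix.mul_assoc, hVA, ofCols_mul_ofBlks, fromCols_mul_fromBlocks]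
    simp [Matrix.mul_nonsing_inv _ hzu]
  set X := U * N with hX
  have hQ23 : zhaQTwo h V₁₁ t * zhaQThree h X = ofBlks h (fromBlocks V₁₁ 0 0 1) *
      ofBlks h (fromBlocks (fromBlocks (rdiag t)⁻¹ 0 0 1) (fromRows (-((rdiag t)⁻¹ * X)) 0) 0 1) := by
    simp [zhaQTwo, zhaQThree, ofBlks_mul, Matrix.mul_assoc, fromBlocks_multiply,
      fromBlocks_mul_fromRows]
  -- The factor `diag(I, diag(z)⁻¹)` commutes with `diag(V₁₁, I)`, so both unitaries can be
  -- collected on the left. The remaining factor is block triangular, and its middle block is the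
  -- identity, decoupled from the rest.
  have hQ : zhaQOne h V₂ z * zhaQTwo h V₁₁ t * zhaQThree h X =
      V₂ * ofBlks h (fromBlocks V₁₁ 0 0 1) * ofBlks h (fromBlocks (fromBlocks (rdiag t)⁻¹ 0 0 1)
        (fromRows (-((rdiag t)⁻¹ * X)) 0) 0 (rdiag z)⁻¹) := by
    rw [Matrix.mul_assoc, hQ23, zhaQOne]
    simp [ofBlks_mul, Matrix.mul_assoc, fromBlocks_multiply]
  have hW : V₂ * ofBlks h (fromBlocks V₁₁ 0 0 1) ∈ unitaryGroup (Fin n) ℂ := by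
    refine mul_mem hV₂ ?_
    rw [mem_unitaryGroup_iff, star_eq_conjTranspose, ofBlks_conjTranspose, ofBlks_mul]
    have := mem_unitaryGroup_iff.1 hV₁₁
    rw [star_eq_conjTranspose] at this
    simp [fromBlocks_conjTranspose, fromBlocks_multiply, this, ofBlks_one]
  refine ⟨⟨hU, hV, ?_, ?_, ?_⟩, ?_⟩
  · rw [hQ, det_mul, det_ofBlks, det_fromBlocks_zero₂₁, det_fromBlocks_zero₂₁, det_nonsing_inv,
      det_nonsing_inv]
    refine (isUnit_det_of_mem_unitaryGroup hW).mul ?_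
    simpa using ⟨isUnit_iff_ne_zero.1 htu, isUnit_iff_ne_zero.1 hzu⟩
  · rw [Matrix.mul_assoc (zhaQOne h V₂ z), hQ23, Matrix.mul_assoc, ← Matrix.mul_assoc A₁, hMN,
      ofBlks_mul, ofCols_mul_ofBlks, mul_ofCols, sigmaOne, fromBlocks_multiply]
    simp only [fromCols_mul_fromBlocks, mul_fromCols, Matrix.mul_zero, Matrix.zero_mul, add_zero,
      zero_add, Matrix.mul_one, Matrix.mul_add, ← Matrix.mul_assoc, hUA]
    simp [fromCols_mul_fromRows, Matrix.mul_nonsing_inv _ htu,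
      ← Matrix.mul_assoc, hX]
  · rw [Matrix.mul_assoc (zhaQOne h V₂ z), hQ23, ← Matrix.mul_assoc, h2,
      ofBlks_mul, ofCols_mul_ofBlks, sigmaTwo, fromBlocks_multiply]
    simp [fromCols_mul_fromBlocks]
  · have hWW := mem_unitaryGroup_iff'.1 hW
    rw [star_eq_conjTranspose] at hWW
    rw [hQ, conjTranspose_mul]
    generalize V₂ * ofBlks h (fromBlocks V₁₁ 0 0 1) = W at hWW
    -- Since `W` is unitary, `Qᴴ Q = Lᴴ L`; it suffices that `L` commutes with the Hermitian matrix
    -- `B`.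
    have hL : ∀ L : Matrix (Fin n) (Fin n) ℂ, matB h * L = L * matB h →
        matB h * ((Lᴴ * Wᴴ) * (W * L)) = (Lᴴ * Wᴴ) * (W * L) * matB h := by
      intro L hL
      have hL' : matB h * Lᴴ = Lᴴ * matB h := by
        simpa [conjTranspose_mul, matB_conjTranspose] using (congrArg conjTranspose hL).symm
      have e : (Lᴴ * Wᴴ) * (W * L) = Lᴴ * L := by
        rw [Matrix.mul_assoc, ← Matrix.mul_assoc Wᴴ, hWW, Matrix.one_mul]
      rw [e, ← Matrix.mul_assoc, hL', Matrix.mul_assoc, hL, Matrix.mul_assoc]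
    refine hL _ ?_
    rw [matB, ofBlks_mul, ofBlks_mul, fromBlocks_multiply, fromBlocks_multiply]
    simp [fromBlocks_multiply, fromBlocks_mul_fromRows]

/-! ### Singular value decompositions and existence of Zha's GSVD. -/

section SingularValues

open scoped ComplexOrder

theorem Matrix.PosDef.exists_unitary_antitone_diagonalization {m : ℕ}
    {A : Matrix (Fin m) (Fin m) ℂ} (hA : A.PosDef) :
    ∃ (U : Matrix (Fin m) (Fin m) ℂ) (t : Fin m → ℝ), U ∈ unitaryGroup (Fin m) ℂ ∧
      Antitone t ∧ (∀ i, 0 < t i) ∧ U * A * Uᴴ = rdiag t * rdiag t := by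
  set E : Matrix (Fin m) (Fin m) ℂ := (hA.isHermitian.eigenvectorUnitary : Matrix (Fin m) (Fin m) ℂ) with hE
  have hEu : Eᴴ * E = 1 := mem_unitaryGroup_iff'.1 hA.isHermitian.eigenvectorUnitary.2
  set l := hA.isHermitian.eigenvalues with hl
  have hspec : A = E * diagonal (fun i => (l i : ℂ)) * Eᴴ := hA.isHermitian.spectral_theorem
  -- `Tuple.sort` sorts increasingly; negation gives the decreasing order.
  set σ := Tuple.sort (fun i => -l i)
  have hσ : Antitone (l ∘ σ) := by
    have := Tuple.monotone_sort (fun i => -l i)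
    exact fun i j hij => neg_le_neg_iff.1 (this hij)
  have hpos : ∀ i, 0 < l i := hA.eigenvalues_pos
  refine ⟨Eᴴ.submatrix σ id, fun i => √(l (σ i)), ?_, fun i j hij => Real.sqrt_le_sqrt (hσ hij),
    fun i => Real.sqrt_pos.2 (hpos _), ?_⟩
  · rw [mem_unitaryGroup_iff, star_eq_conjTranspose, conjTranspose_submatrix,
      conjTranspose_conjTranspose, ← submatrix_mul _ _ _ _ _ Function.bijective_id, hEu,
      submatrix_one_equiv]
  · rw [conjTranspose_submatrix, conjTranspose_conjTranspose]
    have : (Eᴴ * A * E).submatrix σ σ = Eᴴ.submatrix σ id * A * E.submatrix id σ := rfl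
    rw [← this, hspec]
    have e2 : Eᴴ * (E * diagonal (fun i => (l i : ℂ)) * Eᴴ) * E = diagonal (fun i => (l i : ℂ)) := by
      calc _ = (Eᴴ * E) * diagonal (fun i => (l i : ℂ)) * (Eᴴ * E) := by
            simp only [Matrix.mul_assoc]
        _ = _ := by rw [hEu]; simp
    rw [e2, rdiag, diagonal_mul_diagonal, submatrix_diagonal_equiv]
    congr 1
    ext i
    simp [← Complex.ofReal_mul, Real.mul_self_sqrt (hpos _).le]

/-- The conjugated rows of `R` are orthonormal; extended to an orthonormal basis, they become the
columns of `V` at the positions `e i`. A free `e` serves both block layouts: `(O diag(z))` and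
`(diag(t) O)`. -/
theorem Matrix.exists_unitary_extension {m : ℕ} {κ : Type*} [Fintype κ] [DecidableEq κ]
    {e : Fin m → κ} (he : Function.Injective e) {R : Matrix (Fin m) κ ℂ} (hR : R * Rᴴ = 1) :
    ∃ V ∈ unitaryGroup κ ℂ, R * V = of fun i j => if j = e i then 1 else 0 := by
  let w : Fin m → EuclideanSpace ℂ κ := fun i => WithLp.toLp 2 (star (R i))
  have hw : ∀ i j, inner ℂ (w i) (w j) = if i = j then (1 : ℂ) else 0 := by
    intro i j
    have : (R * Rᴴ) i j = if i = j then (1 : ℂ) else 0 := by rw [hR, one_apply]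
    rw [← this, mul_apply, PiLp.inner_apply]
    refine Finset.sum_congr rfl fun k _ => ?_
    simp [w, mul_comm]
  obtain ⟨b, hb⟩ := Orthonormal.exists_orthonormalBasis_extension_of_card_eq (𝕜 := ℂ)
    (E := EuclideanSpace ℂ κ) (ι := κ) (by simp) (v := Function.extend e w 0)
    (s := Set.range e) (by
      rw [orthonormal_iff_ite]
      rintro ⟨_, i, rfl⟩ ⟨_, j, rfl⟩
      simp only [Set.domRestrict, he.extend_apply, hw]
      exact if_congr ⟨fun h => Subtype.ext (congrArg e h), fun h => he (congrArg Subtype.val h)⟩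
        rfl rfl)
  have hb' : ∀ i, b (e i) = w i := fun i => by rw [hb _ ⟨i, rfl⟩, he.extend_apply]
  have hbi := orthonormal_iff_ite.1 b.orthonormal
  refine ⟨of fun k j => b j k, ?_, ?_⟩
  · rw [mem_unitaryGroup_iff', star_eq_conjTranspose]
    ext i j
    rw [one_apply, ← hbi, mul_apply, PiLp.inner_apply]
    refine Finset.sum_congr rfl fun k _ => ?_
    simp [mul_comm]
  · ext i j
    have := hbi (e i) j
    rw [hb'] at this
    simp only [of_apply, eq_comm (a := j)]
    rw [← this, mul_apply, PiLp.inner_apply]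
    refine Finset.sum_congr rfl fun k _ => ?_
    simp [w, mul_comm]

theorem Matrix.exists_singularValueDecomposition {m : ℕ} {κ : Type*} [Fintype κ] [DecidableEq κ]
    {e : Fin m → κ} (he : Function.Injective e) {A : Matrix (Fin m) κ ℂ} (hA : (A * Aᴴ).PosDef) :
    ∃ (U : Matrix (Fin m) (Fin m) ℂ) (V : Matrix κ κ ℂ) (t : Fin m → ℝ),
      U ∈ unitaryGroup (Fin m) ℂ ∧ V ∈ unitaryGroup κ ℂ ∧ Antitone t ∧ (∀ i, 0 < t i) ∧
      U * A * V = of fun i j => if j = e i then (t i : ℂ) else 0 := by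
  obtain ⟨U, t, hU, ht, htp, hUA⟩ := hA.exists_unitary_antitone_diagonalization
  have htu := isUnit_det_rdiag htp
  -- `U` diagonalizes `A Aᴴ`, so the rows of `U A` are orthogonal with norms `t i`; rescaling makes
  -- them orthonormal.
  have hR : ((rdiag t)⁻¹ * U * A) * ((rdiag t)⁻¹ * U * A)ᴴ = 1 := by
    calc _ = (rdiag t)⁻¹ * (U * (A * Aᴴ) * Uᴴ) * (rdiag t)⁻¹ := by
          simp only [conjTranspose_mul, conjTranspose_nonsing_inv, rdiag_conjTranspose,
            Matrix.mul_assoc]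
      _ = _ := by
          rw [hUA, ← Matrix.mul_assoc, Matrix.nonsing_inv_mul _ htu, Matrix.one_mul,
            Matrix.mul_nonsing_inv _ htu]
  obtain ⟨V, hV, hRV⟩ := Matrix.exists_unitary_extension he hR
  refine ⟨U, V, t, hU, hV, ht, htp, ?_⟩
  have : U * A * V = rdiag t * ((rdiag t)⁻¹ * U * A * V) := by
    simp only [← Matrix.mul_assoc, Matrix.mul_nonsing_inv _ htu, Matrix.one_mul]
  rw [this, hRV]
  ext i j
  simp [rdiag, diagonal_mul]

theorem Matrix.posDef_mul_conjTranspose_self_iff {ι κ : Type*} [Fintype ι] [Fintype κ]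
    {A : Matrix ι κ ℂ} : (A * Aᴴ).PosDef ↔ ∀ x : ι → ℂ, x ᵥ* A = 0 → x = 0 := by
  rw [show (∀ x : ι → ℂ, x ᵥ* A = 0 → x = 0) ↔ Function.Injective A.vecMul from
    (injective_iff_map_eq_zero A.vecMulLinear).symm]
  classical
  refine ⟨fun h => ?_, fun h => PosDef.mul_conjTranspose_self A h⟩
  intro x y hxy
  have hu := Matrix.vecMul_injective_of_isUnit h.isUnit
  apply hu
  simp only [← vecMul_vecMul] at *
  exact congrArg (fun v => v ᵥ* Aᴴ) hxy

theorem exists_isZhaGSVD {m n : ℕ} (h : 2 * m < n) {A₁ A₂ : Matrix (Fin m) (Fin n) ℂ}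
    (hA : (stacked A₁ A₂ * (stacked A₁ A₂)ᴴ).PosDef) :
    ∃ (U V : Matrix (Fin m) (Fin m) ℂ) (Q : Matrix (Fin n) (Fin n) ℂ),
      IsZhaGSVD h A₁ A₂ U V Q := by
  rw [posDef_mul_conjTranspose_self_iff] at hA
  have hA' : ∀ x y : Fin m → ℂ, x ᵥ* A₁ = y ᵥ* A₂ → x = 0 ∧ y = 0 := by
    intro x y hxy
    have := hA (Sum.elim x (-y)) (by simp [stacked, vecMul_fromRows, hxy, neg_vecMul])
    constructor
    · ext i; simpa using congrFun this (Sum.inl i)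
    · ext i; simpa using congrFun this (Sum.inr i)
  have hA₂ : (A₂ * A₂ᴴ).PosDef :=
    posDef_mul_conjTranspose_self_iff.2 fun y hy => (hA' 0 y (by simp [hy])).2
  obtain ⟨V, V₂, z, hV, hV₂, hz, hzp, hVA⟩ := Matrix.exists_singularValueDecomposition
    (e := fun i => blk h (Sum.inr i)) ((blk h).injective.comp Sum.inr_injective) hA₂
  have hVA' : V * A₂ * V₂ = ofCols h (fromCols 0 (rdiag z)) := by
    rw [hVA]
    ext i j
    obtain ⟨j, rfl⟩ := (blk h).surjective j
    rcases j with j | j <;> simp [ofCols, rdiag, diagonal_apply, eq_comm]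
  have h2 : V * A₂ * zhaQOne h V₂ z = ofCols h (fromCols 0 1) := by
    rw [zhaQOne, ← Matrix.mul_assoc, hVA', ofCols_mul_ofBlks, fromCols_mul_fromBlocks]
    simp [Matrix.mul_nonsing_inv _ (isUnit_det_rdiag hzp)]
  have hQ1 : IsUnit (zhaQOne h V₂ z) := by
    rw [isUnit_iff_isUnit_det, zhaQOne, det_mul, det_ofBlks, det_fromBlocks_zero₂₁, det_nonsing_inv]
    refine (isUnit_det_of_mem_unitaryGroup hV₂).mul ?_
    simpa using (isUnit_det_rdiag hzp).ne_zero
  set M := firstCols h (A₁ * zhaQOne h V₂ z) with hM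
  set N := lastCols h (A₁ * zhaQOne h V₂ z) with hN
  have hMN : A₁ * zhaQOne h V₂ z = ofCols h (fromCols M N) :=
    (ofCols_firstCols_lastCols h _).symm
  -- If `x M = 0`, then `x A₁ Q₁ = (0, x N) = (x N) V A₂ Q₁`. Cancelling `Q₁` gives a relation
  -- between the rows of `A₁` and `A₂`, so `x = 0`.
  have hMpos : (M * Mᴴ).PosDef := by
    refine posDef_mul_conjTranspose_self_iff.2 fun x hx => ?_
    refine (hA' x ((x ᵥ* N) ᵥ* V) ?_).1
    apply Matrix.vecMul_injective_of_isUnit hQ1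
    dsimp only
    rw [vecMul_vecMul, vecMul_vecMul, vecMul_vecMul, ← Matrix.mul_assoc V, h2,
      hMN]
    ext j
    obtain ⟨j, rfl⟩ := (blk h).surjective j
    rcases j with j | j
    · simpa [ofCols, vecMul, dotProduct] using congrFun hx j
    · simp [ofCols, vecMul, dotProduct, one_apply]
  obtain ⟨U, V₁₁, t, hU, hV₁₁, ht, htp, hUA⟩ := Matrix.exists_singularValueDecomposition
    (e := fun i => (Sum.inl i : Fin m ⊕ Fin (n - 2 * m))) Sum.inl_injective hMpos
  refine ⟨U, V, _, V₂, z, V₁₁, t, hV, hV₂, hz, hzp, hVA', hU, hV₁₁, ht, htp, ?_, rfl⟩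
  rw [hUA]
  ext i (j | j) <;> simp [rdiag, diagonal_apply, eq_comm]

end SingularValues

/-! ### Integrals and densities on finite products. -/

section ProductMeasures

open scoped ENNReal

variable {ι : Type*} [DecidableEq ι] {X : ι → Type*} [∀ i, MeasurableSpace (X i)]

/-- Marginals over a finset allow induction, one coordinate at a time. -/
theorem MeasureTheory.lmarginal_prod (μ : ∀ i, Measure (X i)) [∀ i, SigmaFinite (μ i)]
    {f : ∀ i, X i → ℝ≥0∞} (hf : ∀ i, Measurable (f i)) (s : Finset ι) (x : ∀ i, X i) :
    lmarginal μ s (fun x => ∏ i ∈ s, f i (x i)) x = ∏ i ∈ s, ∫⁻ y, f i y ∂μ i := by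
  induction s using Finset.induction generalizing x with
  | empty => simp
  | insert i s hi ih =>
    have hm : ∀ s : Finset ι, Measurable fun x : ∀ i, X i => ∏ i ∈ s, f i (x i) := fun s =>
      Finset.measurable_prod _ fun j _ => (hf j).comp (measurable_pi_apply j)
    have e : ∀ x : ∀ i, X i, ∫⁻ y, ∏ j ∈ insert i s, f j (Function.update x i y j) ∂μ i =
        (∫⁻ y, f i y ∂μ i) * ∏ j ∈ s, f j (x j) := by
      intro x
      rw [← lintegral_mul_const _ (hf i)]
      refine lintegral_congr fun y => ?_
      rw [Finset.prod_insert hi, Function.update_self]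
      congr 1
      refine Finset.prod_congr rfl fun j hj => ?_
      rw [Function.update_of_ne (by rintro rfl; exact hi hj)]
    rw [lmarginal_insert' _ (hm _) hi]
    simp only [e]
    rw [Finset.prod_insert hi, ← ih x, lmarginal, lmarginal, lintegral_const_mul]
    exact (hm s).comp measurable_updateFinset

theorem MeasureTheory.lintegral_pi_prod [Fintype ι] (μ : ∀ i, Measure (X i)) [∀ i, SigmaFinite (μ i)]
    {f : ∀ i, X i → ℝ≥0∞} (hf : ∀ i, Measurable (f i)) :
    ∫⁻ x, ∏ i, f i (x i) ∂Measure.pi μ = ∏ i, ∫⁻ y, f i y ∂μ i := by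
  rcases isEmpty_or_nonempty (∀ i, X i) with h | ⟨⟨x⟩⟩
  · obtain ⟨i, hi⟩ := isEmpty_pi.1 h
    rw [lintegral_of_isEmpty, eq_comm]
    exact Finset.prod_eq_zero (Finset.mem_univ i) (lintegral_of_isEmpty _ _)
  · rw [lintegral_eq_lmarginal_univ x, lmarginal_prod μ hf]

theorem MeasureTheory.Measure.pi_withDensity [Fintype ι] (μ : ∀ i, Measure (X i)) [∀ i, SigmaFinite (μ i)]
    {f : ∀ i, X i → ℝ≥0∞} (hf : ∀ i, Measurable (f i))
    [∀ i, SigmaFinite ((μ i).withDensity (f i))] :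
    Measure.pi (fun i => (μ i).withDensity (f i)) =
      (Measure.pi μ).withDensity (fun x => ∏ i, f i (x i)) := by
  refine Measure.pi_eq fun s hs => ?_
  rw [withDensity_apply _ (MeasurableSet.univ_pi hs), ← lintegral_indicator (MeasurableSet.univ_pi hs)]
  simp_rw [fun i => withDensity_apply (f i) (hs i), ← fun i => lintegral_indicator (μ := μ i) (hs i) (f i)]
  rw [← lintegral_pi_prod μ fun i => (hf i).indicator (hs i)]
  refine lintegral_congr fun x => ?_
  by_cases hx : x ∈ Set.univ.pi s
  · rw [Set.indicator_of_mem hx]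
    exact Finset.prod_congr rfl fun i _ => (Set.indicator_of_mem (hx i trivial) _).symm
  · rw [Set.indicator_of_notMem hx]
    obtain ⟨i, hi⟩ : ∃ i, x i ∉ s i := by simpa using hx
    exact (Finset.prod_eq_zero (Finset.mem_univ i) (Set.indicator_of_notMem hi _)).symm

/-- Replacing one coordinate by an independent copy preserves a product of probability measures. -/
theorem MeasureTheory.measurePreserving_update [Fintype ι] (μ : ∀ i, Measure (X i))
    [∀ i, IsProbabilityMeasure (μ i)] (i : ι) :
    MeasurePreserving (fun p : (∀ i, X i) × X i => Function.update p.1 i p.2)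
      ((Measure.pi μ).prod (μ i)) (Measure.pi μ) := by
  have hm : Measurable fun p : (∀ i, X i) × X i => Function.update p.1 i p.2 := by
    rw [measurable_pi_iff]
    intro j
    by_cases hj : j = i
    · subst hj; simpa using measurable_snd
    · simp only [Function.update_of_ne hj]; fun_prop
  refine ⟨hm, (Measure.pi_eq fun s hs => ?_).symm⟩
  rw [Measure.map_apply hm (MeasurableSet.univ_pi hs)]
  have e : (fun p : (∀ i, X i) × X i => Function.update p.1 i p.2) ⁻¹' Set.univ.pi s =
      Set.univ.pi (Function.update s i Set.univ) ×ˢ s i := by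
    ext ⟨x, y⟩
    simp only [Set.mem_preimage, Set.mem_pi, Set.mem_univ, true_implies, Set.mem_prod]
    constructor
    · refine fun h => ⟨fun j => ?_, by simpa using h i⟩
      by_cases hj : j = i
      · subst hj; simp
      · simpa [hj] using h j
    · rintro ⟨h, hy⟩ j
      by_cases hj : j = i
      · subst hj; simpa using hy
      · simpa [hj] using h j
  rw [e, Measure.prod_prod, Measure.pi_pi, ← Finset.prod_erase_mul _ _ (Finset.mem_univ i),
    ← Finset.prod_erase_mul (a := i) Finset.univ (fun i => μ i (s i)) (Finset.mem_univ i)]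
  simp only [Function.update_self, measure_univ, mul_one]
  congr 1
  refine Finset.prod_congr rfl fun j hj => ?_
  rw [Function.update_of_ne (Finset.ne_of_mem_erase hj)]

end ProductMeasures

/-! ### Complex Gaussian vectors and linear changes of variables. -/

section ComplexGaussian

open scoped ENNReal

theorem stdComplexGaussian_eq_withDensity :
    stdComplexGaussian =
      volume.withDensity fun z : ℂ => ENNReal.ofReal (Real.pi⁻¹ * Real.exp (-‖z‖ ^ 2)) := by
  have hv : (1 / 2 : NNReal) ≠ 0 := by norm_num
  rw [stdComplexGaussian, gaussianReal_of_var_ne_zero _ hv,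
    prod_withDensity (measurable_gaussianPDF _ _) (measurable_gaussianPDF _ _)]
  ext s hs
  have hmp := Complex.volume_preserving_equiv_real_prod.symm
  rw [Measure.map_apply (MeasurableEquiv.measurable _) hs,
    withDensity_apply _ (MeasurableEquiv.measurable _ hs), withDensity_apply _ hs,
    ← hmp.setLIntegral_comp_preimage_emb (MeasurableEquiv.measurableEmbedding _)]
  refine lintegral_congr fun p => ?_
  rw [gaussianPDF, gaussianPDF, ← ENNReal.ofReal_mul (gaussianPDFReal_nonneg _ _ _)]
  congr 1
  have h2 : ‖Complex.measurableEquivRealProd.symm p‖ ^ 2 = p.1 ^ 2 + p.2 ^ 2 := by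
    rw [← Complex.normSq_eq_norm_sq, Complex.normSq_apply]
    simp [Complex.measurableEquivRealProd, sq]
  rw [h2, gaussianPDFReal, gaussianPDFReal]
  have : ((1 / 2 : NNReal) : ℝ) = 1 / 2 := by simp
  rw [this, show 2 * Real.pi * (1 / 2) = Real.pi by ring, neg_add, Real.exp_add]
  have h3 : √Real.pi ^ 2 = Real.pi := Real.sq_sqrt Real.pi_pos.le
  have h4 : √Real.pi ≠ 0 := (Real.sqrt_pos.2 Real.pi_pos).ne'
  rw [show Real.pi⁻¹ = (√Real.pi)⁻¹ * (√Real.pi)⁻¹ by rw [← mul_inv, ← sq, h3]]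
  simp
  ring

instance : IsProbabilityMeasure stdComplexGaussian :=
  Measure.isProbabilityMeasure_map (MeasurableEquiv.measurable _).aemeasurable

/-- The law of a vector of independent standard complex Gaussian variables. -/
noncomputable def stdComplexGaussianVec (κ : Type*) [Fintype κ] : Measure (κ → ℂ) :=
  Measure.pi fun _ => stdComplexGaussian

variable {κ : Type*} [Fintype κ]

instance : IsProbabilityMeasure (stdComplexGaussianVec κ) := by
  unfold stdComplexGaussianVec; infer_instance

/-- The density of a vector of independent standard complex Gaussian variables. -/
noncomputable def stdComplexGaussianVecPDF (y : κ → ℂ) : ℝ≥0∞ :=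
  ENNReal.ofReal ((Real.pi⁻¹) ^ Fintype.card κ * Real.exp (-∑ j, ‖y j‖ ^ 2))

theorem measurable_stdComplexGaussianVecPDF :
    Measurable (stdComplexGaussianVecPDF : (κ → ℂ) → ℝ≥0∞) := by
  unfold stdComplexGaussianVecPDF; fun_prop

theorem stdComplexGaussianVec_eq_withDensity :
    stdComplexGaussianVec κ = volume.withDensity stdComplexGaussianVecPDF := by
  classical
  have : SigmaFinite (volume.withDensity fun z : ℂ =>
      ENNReal.ofReal (Real.pi⁻¹ * Real.exp (-‖z‖ ^ 2))) := by
    rw [← stdComplexGaussian_eq_withDensity]; infer_instance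
  rw [stdComplexGaussianVec, stdComplexGaussian_eq_withDensity,
    Measure.pi_withDensity _ fun _ => by fun_prop, ← volume_pi]
  congr 1
  ext y
  rw [← ENNReal.ofReal_prod_of_nonneg fun _ _ => by positivity, stdComplexGaussianVecPDF,
    Finset.prod_mul_distrib, ← Real.exp_sum, Finset.sum_neg_distrib]
  simp

theorem stdComplexGaussianVec_submodule {S : Submodule ℂ (κ → ℂ)} (hS : S ≠ ⊤) :
    stdComplexGaussianVec κ S = 0 := by
  have hac : stdComplexGaussianVec κ ≪ volume := by
    rw [stdComplexGaussianVec_eq_withDensity]; exact withDensity_absolutelyContinuous _ _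
  apply hac
  exact Measure.addHaar_submodule volume (S.restrictScalars ℝ) (by simpa using hS)

/-- The real determinant of a complex linear map is the squared modulus of its complex determinant.
-/
theorem lintegral_comp_vecMul [DecidableEq κ] {A : Matrix κ κ ℂ} (hA : A.det ≠ 0)
    {f : (κ → ℂ) → ℝ≥0∞} (hf : Measurable f) :
    ∫⁻ y, f (y ᵥ* A) = ENNReal.ofReal ((‖A.det‖ ^ 2)⁻¹) * ∫⁻ y, f y := by
  set L : (κ → ℂ) →ₗ[ℝ] (κ → ℂ) := (Matrix.toLin' Aᵀ).restrictScalars ℝ with hL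
  have hLdet : LinearMap.det L = ‖A.det‖ ^ 2 := by
    rw [hL, LinearMap.det_restrictScalars, LinearMap.det_toLin', det_transpose,
      Algebra.norm_complex_apply, Complex.normSq_eq_norm_sq]
  have hne : LinearMap.det L ≠ 0 := by rw [hLdet]; simpa using hA
  have hmap := Measure.map_linearMap_addHaar_eq_smul_addHaar (volume : Measure (κ → ℂ)) hne
  have hmeas : Measurable L := L.continuous_of_finiteDimensional.measurable
  have := lintegral_map (μ := volume) hf hmeas
  rw [hmap, lintegral_smul_measure, hLdet] at this
  rw [abs_of_nonneg (by positivity)] at this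
  simpa [hL, mulVec_transpose] using this.symm

/-- The hypothesis on `q` says that `exp(-q y)` times the Gaussian density at `y` is the density at
`y ᵥ* A`; only the Jacobian remains. -/
theorem lintegral_exp_neg_stdComplexGaussianVec [DecidableEq κ] {A : Matrix κ κ ℂ} (hA : A.det ≠ 0)
    {q : (κ → ℂ) → ℝ} (hqm : Measurable q)
    (hq : ∀ y, ∑ j, ‖(y ᵥ* A) j‖ ^ 2 = ∑ j, ‖y j‖ ^ 2 + q y) :
    ∫⁻ y, ENNReal.ofReal (Real.exp (-q y)) ∂stdComplexGaussianVec κ =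
      ENNReal.ofReal ((‖A.det‖ ^ 2)⁻¹) := by
  have h1 : ∫⁻ y : κ → ℂ, stdComplexGaussianVecPDF y = 1 := by
    have : stdComplexGaussianVec κ Set.univ = 1 := measure_univ
    rwa [stdComplexGaussianVec_eq_withDensity, withDensity_apply _ MeasurableSet.univ,
      setLIntegral_univ] at this
  rw [stdComplexGaussianVec_eq_withDensity, lintegral_withDensity_eq_lintegral_mul _
    measurable_stdComplexGaussianVecPDF (by fun_prop), ← mul_one (ENNReal.ofReal _), ← h1,
    ← lintegral_comp_vecMul hA measurable_stdComplexGaussianVecPDF]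
  refine lintegral_congr fun y => ?_
  rw [Pi.mul_apply, stdComplexGaussianVecPDF, stdComplexGaussianVecPDF, hq,
    ← ENNReal.ofReal_mul (by positivity), mul_assoc, ← Real.exp_add, neg_add]

end ComplexGaussian

theorem sum_norm_sq_eq_dotProduct_star {κ : Type*} [Fintype κ] (y : κ → ℂ) :
    ((∑ j, ‖y j‖ ^ 2 : ℝ) : ℂ) = y ⬝ᵥ star y := by
  rw [dotProduct]
  push_cast
  refine Finset.sum_congr rfl fun j _ => ?_
  simp [Complex.mul_conj, Complex.normSq_eq_norm_sq]

theorem Matrix.vecMul_dotProduct_star_vecMul {κ : Type*} [Fintype κ] (B : Matrix κ κ ℂ) (y : κ → ℂ) :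
    (y ᵥ* B) ⬝ᵥ star (y ᵥ* B) = (y ᵥ* (B * Bᴴ)) ⬝ᵥ star y := by
  rw [star_vecMul, dotProduct_mulVec, vecMul_vecMul]

/-! ### Distance to a row space and the inverse Gram matrix. -/

section Projection

variable {ι κ : Type*} [Fintype ι] [DecidableEq ι] [Fintype κ] [DecidableEq κ]

/-- The orthogonal projection, acting on row vectors, along the row space of `A`. -/
noncomputable def Matrix.rowCoprojection (A : Matrix ι κ ℂ) : Matrix κ κ ℂ :=
  1 - Aᴴ * (A * Aᴴ)⁻¹ * A

variable {A : Matrix ι κ ℂ}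

theorem Matrix.rowCoprojection_conjTranspose : A.rowCoprojectionᴴ = A.rowCoprojection := by
  simp [rowCoprojection, conjTranspose_nonsing_inv, Matrix.mul_assoc]

theorem Matrix.mul_rowCoprojection (hA : IsUnit (A * Aᴴ).det) : A * A.rowCoprojection = 0 := by
  rw [rowCoprojection, Matrix.mul_sub, Matrix.mul_one, ← Matrix.mul_assoc, ← Matrix.mul_assoc,
    Matrix.mul_nonsing_inv _ hA, Matrix.one_mul, sub_self]

theorem Matrix.rowCoprojection_mul_self (hA : IsUnit (A * Aᴴ).det) :
    A.rowCoprojection * A.rowCoprojection = A.rowCoprojection := by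
  conv_lhs => enter [1]; rw [rowCoprojection]
  rw [Matrix.sub_mul, Matrix.mul_assoc, mul_rowCoprojection hA]
  simp

theorem Matrix.vecMul_rowCoprojection_of_orthogonal {z : κ → ℂ} (hz : z ᵥ* Aᴴ = 0) :
    z ᵥ* A.rowCoprojection = z := by
  rw [rowCoprojection, vecMul_sub, vecMul_one, ← vecMul_vecMul, ← vecMul_vecMul, hz]
  simp

/-- The matrix acts as `a` on the orthogonal complement of the row space and as `1` on the row
space. The identity `det(1 - XY) = det(1 - YX)` reduces the determinant to that of a scalar `ι × ι`
matrix. -/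
theorem Matrix.det_one_add_smul_rowCoprojection (hA : IsUnit (A * Aᴴ).det)
    (hcard : Fintype.card ι ≤ Fintype.card κ) {a : ℂ} (ha : a ≠ 0) :
    (1 + (a - 1) • A.rowCoprojection).det = a ^ (Fintype.card κ - Fintype.card ι) := by
  have e : 1 + (a - 1) • A.rowCoprojection =
      a • (1 - ((a - 1) / a) • Aᴴ * ((A * Aᴴ)⁻¹ * A)) := by
    rw [rowCoprojection, smul_sub, smul_sub, smul_mul, smul_smul, mul_div_cancel₀ _ ha,
      Matrix.mul_assoc, sub_smul, one_smul]
    abel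
  rw [e, det_smul, det_one_sub_mul_comm, Matrix.mul_smul, Matrix.mul_assoc,
    Matrix.nonsing_inv_mul _ hA]
  have e2 : (1 : Matrix ι ι ℂ) - ((a - 1) / a) • (1 : Matrix ι ι ℂ) = a⁻¹ • (1 : Matrix ι ι ℂ) := by
    have h1 : 1 - (a - 1) / a = a⁻¹ := by field_simp; ring
    rw [← h1, sub_smul, one_smul]
  rw [e2, det_smul, det_one, mul_one, inv_pow, pow_sub₀ _ ha hcard]

/-- The squared length of the component of `y` orthogonal to the rows of `A`. -/
noncomputable def Matrix.sqDistRows (A : Matrix ι κ ℂ) (y : κ → ℂ) : ℝ :=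
  ∑ j, ‖(y ᵥ* A.rowCoprojection) j‖ ^ 2

theorem Matrix.sqDistRows_eq (hA : IsUnit (A * Aᴴ).det) (y : κ → ℂ) :
    (A.sqDistRows y : ℂ) = (y ᵥ* A.rowCoprojection) ⬝ᵥ star y := by
  rw [sqDistRows, sum_norm_sq_eq_dotProduct_star, vecMul_dotProduct_star_vecMul,
    rowCoprojection_conjTranspose, rowCoprojection_mul_self hA]

theorem Matrix.sqDistRows_nonneg (y : κ → ℂ) : 0 ≤ A.sqDistRows y :=
  Finset.sum_nonneg fun _ _ => by positivity

theorem Matrix.sum_norm_sq_vecMul_one_add_smul_rowCoprojection (hA : IsUnit (A * Aᴴ).det)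
    (a : ℝ) (y : κ → ℂ) :
    ∑ j, ‖(y ᵥ* (1 + ((a : ℂ) - 1) • A.rowCoprojection)) j‖ ^ 2 =
      ∑ j, ‖y j‖ ^ 2 + (a ^ 2 - 1) * A.sqDistRows y := by
  apply Complex.ofReal_injective
  rw [sum_norm_sq_eq_dotProduct_star, vecMul_dotProduct_star_vecMul]
  have e : (1 + ((a : ℂ) - 1) • A.rowCoprojection) * (1 + ((a : ℂ) - 1) • A.rowCoprojection)ᴴ =
      1 + ((a : ℂ) ^ 2 - 1) • A.rowCoprojection := by
    rw [conjTranspose_add, conjTranspose_one, conjTranspose_smul, rowCoprojection_conjTranspose]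
    have : star ((a : ℂ) - 1) = (a : ℂ) - 1 := by simp
    rw [this, Matrix.add_mul, Matrix.one_mul, Matrix.mul_add, Matrix.mul_one, Matrix.smul_mul, Matrix.mul_smul,
      rowCoprojection_mul_self hA, smul_smul, add_assoc, ← add_smul, ← add_smul]
    congr 2
    ring
  rw [e, Complex.ofReal_add, sum_norm_sq_eq_dotProduct_star, Complex.ofReal_mul, sqDistRows_eq hA,
    vecMul_add, vecMul_one, add_dotProduct, vecMul_smul, smul_dotProduct]
  simp

end Projection

/-- The rows of `G = (H Hᴴ)⁻¹ H` are dual to those of `H`. Row `i` of `G` is orthogonal to the other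
rows of `H`, so the projection fixes it; the projection also kills those other rows, so row `i` of
`G` is `(H Hᴴ)⁻¹ i i` times the projected `H i`. Pairing with `H i` gives `1`. -/
theorem Matrix.inv_gram_apply_self {ι κ : Type*} [Fintype ι] [DecidableEq ι] [Fintype κ]
    [DecidableEq κ] (H : Matrix ι κ ℂ) (hH : IsUnit (H * Hᴴ).det) (i : ι)
    (hH' : IsUnit ((H.submatrix (Subtype.val : {j // j ≠ i} → ι) id) *
      (H.submatrix (Subtype.val : {j // j ≠ i} → ι) id)ᴴ).det) :
    (H * Hᴴ)⁻¹ i i =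
      ((((H.submatrix (Subtype.val : {j // j ≠ i} → ι) id).sqDistRows (H i))⁻¹ : ℝ) : ℂ) := by
  set A := H.submatrix (Subtype.val : {j // j ≠ i} → ι) id with hA
  set G := (H * Hᴴ)⁻¹ * H with hG
  have hGH : G * Hᴴ = 1 := by rw [hG, Matrix.mul_assoc, Matrix.nonsing_inv_mul _ hH]
  have hrow : ∀ j, j ≠ i → (H * A.rowCoprojection) j = 0 := fun j hj => by
    ext k
    exact congrFun (congrFun (mul_rowCoprojection hH') ⟨j, hj⟩) k
  have h1 : G i ᵥ* A.rowCoprojection = G i := by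
    refine vecMul_rowCoprojection_of_orthogonal ?_
    ext j
    have : (G * Hᴴ) i j = 0 := by rw [hGH, one_apply_ne j.2.symm]
    exact this
  have h2 : G i ᵥ* A.rowCoprojection = (H * Hᴴ)⁻¹ i i • (H i ᵥ* A.rowCoprojection) := by
    have e : G i ᵥ* A.rowCoprojection = ((H * Hᴴ)⁻¹ * (H * A.rowCoprojection)) i := by
      rw [← Matrix.mul_assoc]; rfl
    rw [e]
    ext k
    rw [mul_apply, Finset.sum_eq_single i]
    · rfl
    · intro j _ hj; rw [hrow j hj]; simp
    · simp
  have h3 : G i ⬝ᵥ star (H i) = 1 := by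
    have : (G * Hᴴ) i i = 1 := by rw [hGH, one_apply_eq]
    exact this
  rw [← h1, h2, smul_dotProduct, ← sqDistRows_eq hH', smul_eq_mul] at h3
  rw [Complex.ofReal_inv]
  exact eq_inv_of_mul_eq_one_left h3

/-! ### Mean inverse squared distance, by Laplace transform. -/

section Expectation

open scoped ENNReal

theorem lintegral_Ioi_one_add_pow_inv {d : ℕ} (hd : 2 ≤ d) :
    ∫⁻ t in Set.Ioi (0 : ℝ), ENNReal.ofReal (((1 + t) ^ d)⁻¹) =
      ENNReal.ofReal (((d : ℝ) - 1)⁻¹) := by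
  have hd1 : (1 : ℝ) < d := by exact_mod_cast hd
  have hderiv : ∀ t ∈ Set.Ici (0 : ℝ), HasDerivAt
      (fun t : ℝ => -((d : ℝ) - 1)⁻¹ * ((1 + t) ^ (d - 1))⁻¹) (((1 + t) ^ d)⁻¹) t := by
    intro t ht
    have ht' : (0 : ℝ) < 1 + t := by have : 0 ≤ t := ht; linarith
    obtain ⟨e, rfl⟩ : ∃ e, d = e + 2 := ⟨d - 2, by omega⟩
    have h1 : HasDerivAt (fun t : ℝ => (1 + t) ^ (e + 1)) ((e + 1 : ℕ) * (1 + t) ^ e * 1) t := by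
      exact ((hasDerivAt_id t).const_add 1).fun_pow (e + 1)
    have h2 := (h1.inv (by positivity)).const_mul (-(((e + 2 : ℕ) : ℝ) - 1)⁻¹)
    refine HasDerivAt.congr_deriv h2 ?_
    have h3 : (((e + 2 : ℕ) : ℝ) - 1) = (e : ℝ) + 1 := by push_cast; ring
    have h4 : (e : ℝ) + 1 ≠ 0 := by positivity
    rw [h3]
    push_cast
    field_simp
    ring
  have hlim : Filter.Tendsto (fun t : ℝ => -((d : ℝ) - 1)⁻¹ * ((1 + t) ^ (d - 1))⁻¹)
      Filter.atTop (nhds 0) := by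
    have : Filter.Tendsto (fun t : ℝ => (1 + t) ^ (d - 1)) Filter.atTop Filter.atTop :=
      (Filter.tendsto_pow_atTop (by omega)).comp (Filter.tendsto_atTop_add_const_left _ 1
        Filter.tendsto_id)
    simpa using (tendsto_inv_atTop_zero.comp this).const_mul (-((d : ℝ) - 1)⁻¹)
  have hpos : ∀ t ∈ Set.Ioi (0 : ℝ), 0 ≤ ((1 + t) ^ d)⁻¹ := fun t ht => by
    have : 0 < t := ht
    positivity
  have hint := integrableOn_Ioi_deriv_of_nonneg' hderiv hpos hlim
  rw [← ofReal_integral_eq_lintegral_ofReal hint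
    ((ae_restrict_iff' measurableSet_Ioi).2 (Filter.Eventually.of_forall hpos)),
    integral_Ioi_of_hasDerivAt_of_nonneg' hderiv hpos hlim]
  congr 1
  simp

theorem ENNReal.inv_ofReal_eq_lintegral_exp {x : ℝ} (hx : 0 ≤ x) :
    (ENNReal.ofReal x)⁻¹ = ∫⁻ t in Set.Ioi (0 : ℝ), ENNReal.ofReal (Real.exp (-(t * x))) := by
  rcases hx.eq_or_lt with rfl | hx
  -- At `x = 0` both sides are `∞`.
  · simp
  · have h1 := integral_exp_mul_Ioi (a := -x) (by linarith) 0
    have h2 := integrableOn_exp_mul_Ioi (a := -x) (by linarith) 0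
    have e : ∀ t : ℝ, -(t * x) = -x * t := fun t => by ring
    simp_rw [e]
    rw [← ofReal_integral_eq_lintegral_ofReal h2 (Filter.Eventually.of_forall fun _ => (Real.exp_pos _).le),
      h1, ← ENNReal.ofReal_inv_of_pos hx]
    congr 1
    simp [neg_div]

variable {ι κ : Type*} [Fintype ι] [DecidableEq ι] [Fintype κ] [DecidableEq κ]
  {A : Matrix ι κ ℂ}

theorem Matrix.continuous_sqDistRows : Continuous A.sqDistRows := by
  unfold sqDistRows; fun_prop

/-- Stretching by `a = √(1 + t)` orthogonally to the rows adds `(a² - 1) d² = t d²` to the squared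
norm. -/
theorem lintegral_exp_neg_mul_sqDistRows (hA : IsUnit (A * Aᴴ).det)
    (hcard : Fintype.card ι ≤ Fintype.card κ) {t : ℝ} (ht : 0 ≤ t) :
    ∫⁻ y, ENNReal.ofReal (Real.exp (-(t * A.sqDistRows y))) ∂stdComplexGaussianVec κ =
      ENNReal.ofReal (((1 + t) ^ (Fintype.card κ - Fintype.card ι))⁻¹) := by
  have hs : 0 < √(1 + t) := Real.sqrt_pos.2 (by linarith)
  have hs2 : √(1 + t) ^ 2 = 1 + t := Real.sq_sqrt (by linarith)
  have hne : ((√(1 + t) : ℝ) : ℂ) ≠ 0 := by exact_mod_cast hs.ne'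
  have hdet := det_one_add_smul_rowCoprojection hA hcard hne
  rw [lintegral_exp_neg_stdComplexGaussianVec
    (A := 1 + (((√(1 + t) : ℝ) : ℂ) - 1) • A.rowCoprojection)
    (by rw [hdet]; exact pow_ne_zero _ hne) (continuous_sqDistRows.measurable.const_mul t) ?_, hdet,
    norm_pow, Complex.norm_real, Real.norm_of_nonneg hs.le, ← pow_mul, mul_comm, pow_mul, hs2]
  intro y
  rw [sum_norm_sq_vecMul_one_add_smul_rowCoprojection hA, hs2]
  ring

/-- Tonelli applied to `1/x = ∫ exp(-t x) dt`. The gap of `2` makes `(1 + t)^{-d}` integrable; for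
`2m - 1` rows in dimension `n` it amounts to `2m < n`. -/
theorem lintegral_inv_sqDistRows (hA : IsUnit (A * Aᴴ).det)
    (hcard : Fintype.card ι + 2 ≤ Fintype.card κ) :
    ∫⁻ y, (ENNReal.ofReal (A.sqDistRows y))⁻¹ ∂stdComplexGaussianVec κ =
      ENNReal.ofReal (((Fintype.card κ : ℝ) - Fintype.card ι - 1)⁻¹) := by
  simp_rw [fun y => ENNReal.inv_ofReal_eq_lintegral_exp (A.sqDistRows_nonneg y)]
  rw [lintegral_lintegral_swap]
  · rw [setLIntegral_congr_fun measurableSet_Ioi fun t ht =>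
      lintegral_exp_neg_mul_sqDistRows hA (by omega) (le_of_lt ht),
      lintegral_Ioi_one_add_pow_inv (by omega), Nat.cast_sub (by omega)]
  · have := A.continuous_sqDistRows
    apply Measurable.aemeasurable
    exact ENNReal.measurable_ofReal.comp (Continuous.measurable (by fun_prop))

end Expectation

/-! ### Gaussian matrices: full rank and the mean inverse Gram trace. -/

section GaussianMatrix

open scoped ENNReal ComplexOrder

/-- The law of a matrix with independent standard complex Gaussian entries. -/
noncomputable def stdComplexGaussianMatrix (ι κ : Type*) [Fintype ι] [Fintype κ] :
    Measure (ι → κ → ℂ) :=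
  Measure.pi fun _ => stdComplexGaussianVec κ

variable {ι κ : Type*} [Fintype ι] [Fintype κ]

instance : IsProbabilityMeasure (stdComplexGaussianMatrix ι κ) := by
  unfold stdComplexGaussianMatrix; infer_instance

theorem Matrix.linearIndependent_iff_isUnit_det_gram [DecidableEq ι] (x : ι → κ → ℂ) :
    LinearIndependent ℂ x ↔ IsUnit ((of x) * (of x)ᴴ).det := by
  rw [← isUnit_iff_isUnit_det, show LinearIndependent ℂ x ↔ Function.Injective (of x).vecMul from
    vecMul_injective_iff.symm]
  refine ⟨fun h => (PosDef.mul_conjTranspose_self _ h).isUnit, fun h => ?_⟩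
  have := Matrix.vecMul_injective_of_isUnit h
  intro v w hvw
  apply this
  simp only [← vecMul_vecMul] at *
  exact congrArg (fun v => v ᵥ* (of x)ᴴ) hvw

theorem measurableSet_setOf_linearIndepOn (s : Set ι) :
    MeasurableSet {x : ι → κ → ℂ | LinearIndepOn ℂ x s} := by
  have hc : Continuous fun (x : ι → κ → ℂ) (i : s) => x i := by fun_prop
  exact (isOpen_setOfPred_linearIndependent.preimage hc).measurableSet

/-- Rows are resampled one at a time: the previous rows span a proper subspace, which the fresh row
almost surely avoids. -/
theorem ae_linearIndepOn_stdComplexGaussianMatrix [DecidableEq ι] (s : Finset ι)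
    (hs : s.card ≤ Fintype.card κ) :
    ∀ᵐ x ∂stdComplexGaussianMatrix ι κ, LinearIndepOn ℂ x (s : Set ι) := by
  induction s using Finset.induction with
  | empty => simp
  | insert i s hi ih =>
    rw [Finset.card_insert_of_notMem hi] at hs
    have ih := ih (by omega)
    have hmp := measurePreserving_update (fun _ : ι => stdComplexGaussianVec κ) i
    have hmeas := measurableSet_setOf_linearIndepOn (κ := κ) ((insert i s : Finset ι) : Set ι)
    rw [stdComplexGaussianMatrix, ← hmp.map_eq, ae_map_iff hmp.measurable.aemeasurable hmeas]
    refine (Measure.ae_prod_iff_ae_ae (hmp.measurable hmeas)).2 ?_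
    filter_upwards [ih] with x hx
    have hS : Submodule.span ℂ (x '' s) ≠ ⊤ := by
      intro h
      have h1 := finrank_span_le_card (R := ℂ) (x '' (s : Set ι))
      rw [h, finrank_top, Module.finrank_fintype_fun_eq_card] at h1
      have h2 : (x '' (s : Set ι)).toFinset.card ≤ s.card := by
        rw [Set.toFinset_image]
        simpa using Finset.card_image_le (s := s) (f := x)
      omega
    have hnull := stdComplexGaussianVec_submodule hS
    filter_upwards [measure_eq_zero_iff_ae_notMem.1 hnull] with y hy
    have hcongr : Set.EqOn (Function.update x i y) x s := fun j hj =>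
      Function.update_of_ne (by rintro rfl; exact hi hj) _ _
    rw [Finset.coe_insert, linearIndepOn_insert (by simpa using hi)]
    refine ⟨hx.congr hcongr.symm, ?_⟩
    rwa [hcongr.image_eq, Function.update_self]

theorem ae_linearIndependent_stdComplexGaussianMatrix
    (hcard : Fintype.card ι ≤ Fintype.card κ) :
    ∀ᵐ x ∂stdComplexGaussianMatrix ι κ, LinearIndependent ℂ x := by
  classical
  have := ae_linearIndepOn_stdComplexGaussianMatrix (κ := κ) (Finset.univ : Finset ι) hcard
  simpa [linearIndepOn_univ_iff] using this

/-- By Cramer's rule, each entry is a quotient of continuous functions. -/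
theorem measurable_inv_gram_apply [DecidableEq ι] (i j : ι) :
    Measurable fun x : ι → κ → ℂ => ((of x) * (of x)ᴴ)⁻¹ i j := by
  have hG : Continuous fun x : ι → κ → ℂ => (of x) * (of x)ᴴ := by
    have : Continuous fun x : ι → κ → ℂ => (of x : Matrix ι κ ℂ) := continuous_id
    exact this.matrix_mul this.matrix_conjTranspose
  have h1 : Measurable fun x : ι → κ → ℂ => ((of x) * (of x)ᴴ).det := hG.matrix_det.measurable
  have h2 : Measurable fun x : ι → κ → ℂ => ((of x) * (of x)ᴴ).adjugate i j :=
    ((continuous_apply_apply i j).comp hG.matrix_adjugate).measurable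
  simp only [Matrix.inv_def, Ring.inverse_eq_inv', Matrix.smul_apply, smul_eq_mul]
  exact h1.inv.mul h2

variable [DecidableEq ι] [DecidableEq κ]

/-- For a complex Gaussian `k × n` matrix with `k < n`, the expectation of a diagonal entry of
the inverse Gram matrix is `1 / (n - k)`. -/
theorem lintegral_enorm_inv_gram_apply_self (hcard : Fintype.card ι < Fintype.card κ) (i : ι) :
    ∫⁻ x, ‖((of x) * (of x)ᴴ)⁻¹ i i‖ₑ ∂stdComplexGaussianMatrix ι κ =
      ENNReal.ofReal (((Fintype.card κ : ℝ) - Fintype.card ι)⁻¹) := by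
  have hmp := measurePreserving_update (fun _ : ι => stdComplexGaussianVec κ) i
  have hm : Measurable fun x : ι → κ → ℂ => ‖((of x) * (of x)ᴴ)⁻¹ i i‖ₑ :=
    (measurable_inv_gram_apply i i).enorm
  have hcard' : Fintype.card {j // j ≠ i} + 1 = Fintype.card ι := by
    have := Fintype.card_pos_iff.2 ⟨i⟩
    rw [Fintype.card_subtype_compl, Fintype.card_subtype_eq]
    omega
  have hli : ∀ᵐ x ∂stdComplexGaussianMatrix ι κ, ∀ᵐ y ∂stdComplexGaussianVec κ,
      LinearIndependent ℂ (Function.update x i y) :=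
    Measure.ae_ae_of_ae_prod (hmp.quasiMeasurePreserving.ae
      (ae_linearIndependent_stdComplexGaussianMatrix hcard.le))
  rw [stdComplexGaussianMatrix, ← hmp.lintegral_comp hm]
  refine (lintegral_prod _ (hm.comp hmp.measurable).aemeasurable).trans ?_
  have key : ∀ᵐ x ∂stdComplexGaussianMatrix ι κ,
      ∫⁻ y, ‖((of (Function.update x i y)) * (of (Function.update x i y))ᴴ)⁻¹ i i‖ₑ
        ∂stdComplexGaussianVec κ = ENNReal.ofReal (((Fintype.card κ : ℝ) - Fintype.card ι)⁻¹) := by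
    filter_upwards [hli] with x hx
    set A : Matrix {j // j ≠ i} κ ℂ := of fun j => x j with hA
    have hsub : ∀ y, (of (Function.update x i y)).submatrix (Subtype.val : {j // j ≠ i} → ι) id =
        A := by
      intro y
      ext j k
      simp [hA, Function.update_of_ne j.2]
    have hAu : IsUnit (A * Aᴴ).det := by
      obtain ⟨y, hy⟩ := hx.exists
      have := hy.comp (Subtype.val : {j // j ≠ i} → ι) Subtype.val_injective
      rw [← hsub y]
      exact (linearIndependent_iff_isUnit_det_gram _).1 this
    have hint := lintegral_inv_sqDistRows hAu (by omega)
    have e : (Fintype.card κ : ℝ) - Fintype.card {j // j ≠ i} - 1 =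
        (Fintype.card κ : ℝ) - Fintype.card ι := by rw [← hcard']; push_cast; ring
    rw [e] at hint
    rw [← hint]
    refine lintegral_congr_ae ?_
    filter_upwards [hx] with y hy
    have hyu := (linearIndependent_iff_isUnit_det_gram _).1 hy
    have hv := inv_gram_apply_self (of (Function.update x i y)) hyu i (by rw [hsub]; exact hAu)
    have hne : (of (Function.update x i y) * (of (Function.update x i y))ᴴ)⁻¹ i i ≠ 0 :=
      ((PosDef.mul_conjTranspose_self _ (vecMul_injective_iff.2 hy)).inv.diag_pos (i := i)).ne'
    rw [hsub] at hv
    have hrow : (of (Function.update x i y)) i = y := Function.update_self _ _ _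
    rw [hrow] at hv
    rw [hv] at hne ⊢
    -- Positivity is needed because the inverse of `0` is `0` in `ℝ` but `∞` in `ℝ≥0∞`.
    have hpos : 0 < A.sqDistRows y := by
      refine lt_of_le_of_ne (sqDistRows_nonneg y) fun h0 => hne ?_
      rw [← h0]; simp
    rw [← ENNReal.ofReal_inv_of_pos hpos, ← ofReal_norm, Complex.norm_real,
      Real.norm_of_nonneg (inv_nonneg.2 hpos.le)]
  have := lintegral_congr_ae key
  rw [lintegral_const, measure_univ, mul_one] at this
  exact this

theorem integrable_inv_gram_apply_self (hcard : Fintype.card ι < Fintype.card κ) (i : ι) :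
    Integrable (fun x => ((of x) * (of x)ᴴ)⁻¹ i i) (stdComplexGaussianMatrix ι κ) :=
  ⟨(measurable_inv_gram_apply i i).aestronglyMeasurable, by
    rw [hasFiniteIntegral_iff_enorm, lintegral_enorm_inv_gram_apply_self hcard]
    exact ENNReal.ofReal_lt_top⟩

theorem integral_inv_gram_apply_self (hcard : Fintype.card ι < Fintype.card κ) (i : ι) :
    ∫ x, ((of x) * (of x)ᴴ)⁻¹ i i ∂stdComplexGaussianMatrix ι κ =
      ((((Fintype.card κ : ℝ) - Fintype.card ι)⁻¹ : ℝ) : ℂ) := by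
  have hpos : (0 : ℝ) < (Fintype.card κ : ℝ) - Fintype.card ι := by
    rw [sub_pos]; exact_mod_cast hcard
  -- The diagonal entries are nonnegative, so each equals its norm and the computed `lintegral`
  -- gives the mean itself.
  have hae : (fun x : ι → κ → ℂ => ((of x) * (of x)ᴴ)⁻¹ i i) =
      fun x => ((‖((of x) * (of x)ᴴ)⁻¹ i i‖ : ℝ) : ℂ) := by
    ext x
    have h0 : 0 ≤ ((of x) * (of x)ᴴ)⁻¹ i i :=
      (posSemidef_self_mul_conjTranspose (of x)).inv.diag_nonneg
    exact (Complex.norm_of_nonneg' h0).symm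
  rw [hae, integral_complex_ofReal, integral_norm_eq_lintegral_enorm
    (measurable_inv_gram_apply i i).aestronglyMeasurable, lintegral_enorm_inv_gram_apply_self hcard,
    ENNReal.toReal_ofReal (inv_nonneg.2 hpos.le)]

theorem integrable_trace_inv_gram (hcard : Fintype.card ι < Fintype.card κ) :
    Integrable (fun x => trace (((of x) * (of x)ᴴ)⁻¹)) (stdComplexGaussianMatrix ι κ) :=
  integrable_finsetSum _ fun i _ => integrable_inv_gram_apply_self hcard i

theorem integral_trace_inv_gram (hcard : Fintype.card ι < Fintype.card κ) :
    ∫ x, trace (((of x) * (of x)ᴴ)⁻¹) ∂stdComplexGaussianMatrix ι κ =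
      ((Fintype.card ι * ((Fintype.card κ : ℝ) - Fintype.card ι)⁻¹ : ℝ) : ℂ) := by
  simp only [trace, diag_apply]
  rw [integral_finsetSum _ fun i _ => integrable_inv_gram_apply_self hcard i]
  simp_rw [integral_inv_gram_apply_self hcard]
  simp

end GaussianMatrix

/-- Currying turns the product law over index pairs into a product of row laws. -/
theorem IsGaussianPair.hasLaw_stacked {Ω : Type*} [MeasurableSpace Ω] {μ : Measure Ω}
    [IsProbabilityMeasure μ] {m n : ℕ} {H₁ H₂ : Ω → Matrix (Fin m) (Fin n) ℂ}
    (hH : IsGaussianPair μ H₁ H₂) :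
    HasLaw (fun ω i j => stacked (H₁ ω) (H₂ ω) i j)
      (stdComplexGaussianMatrix (Fin m ⊕ Fin m) (Fin n)) μ := by
  have hae : ∀ p : (Fin m ⊕ Fin m) × Fin n,
      AEMeasurable (fun ω => stacked (H₁ ω) (H₂ ω) p.1 p.2) μ := fun p =>
    (hH.law p.1 p.2).aemeasurable
  have hmap := (iIndepFun_iff_map_fun_eq_pi_map hae).1 hH.indep
  simp_rw [fun p : (Fin m ⊕ Fin m) × Fin n => (hH.law p.1 p.2).map_eq] at hmap
  refine ⟨aemeasurable_pi_iff.2 fun i => aemeasurable_pi_iff.2 fun j => hae (i, j), ?_⟩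
  have hc := Measure.infinitePi_map_curry
    (fun (_ : Fin m ⊕ Fin m) (_ : Fin n) => stdComplexGaussian)
  simp_rw [Measure.infinitePi_eq_pi] at hc
  rw [← hmap, AEMeasurable.map_map_of_aemeasurable (by fun_prop) (aemeasurable_pi_iff.2 hae)] at hc
  exact hc

/-! ### Averaging over the signal. -/

section SignalPower

variable {Ω : Type*} [MeasurableSpace Ω] {μ : Measure Ω} {n : ℕ}

theorem txPower_eq_sum (Q : Matrix (Fin n) (Fin n) ℂ) (s : Fin n → ℂ) :
    txPower Q s = ∑ a, ∑ i, ∑ j, (Q a i * star (Q a j)) * (s i * star (s j)) := by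
  simp only [txPower, trace, diag_apply, mul_apply, conjTranspose_apply, vecMulVec_apply,
    Pi.star_apply, Finset.sum_mul]
  refine Finset.sum_congr rfl fun a _ => ?_
  rw [Finset.sum_comm]
  refine Finset.sum_congr rfl fun i _ => Finset.sum_congr rfl fun j _ => ?_
  ring

theorem trace_mul_mul_conjTranspose_eq_sum (Q B : Matrix (Fin n) (Fin n) ℂ) :
    trace (Q * B * Qᴴ) = ∑ a, ∑ i, ∑ j, (Q a i * star (Q a j)) * B i j := by
  simp only [trace, diag_apply, mul_apply, conjTranspose_apply, Finset.sum_mul]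
  refine Finset.sum_congr rfl fun a _ => ?_
  rw [Finset.sum_comm]
  refine Finset.sum_congr rfl fun i _ => Finset.sum_congr rfl fun j _ => ?_
  ring

/-- For a random vector `s` independent of a random matrix `Q` with square-integrable entries in
the columns that `s` charges, the mean of `tr(Q s sᴴ Qᴴ)` only depends on `E[s sᴴ]`. -/
theorem integral_txPower {Q : Ω → Matrix (Fin n) (Fin n) ℂ} {s : Ω → Fin n → ℂ}
    {B : Matrix (Fin n) (Fin n) ℂ} {S : Set (Fin n)}
    (hQ : ∀ a, ∀ i ∈ S, MemLp (fun ω => Q ω a i) 2 μ)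
    (hind : IndepFun (fun ω i j => Q ω i j) s μ)
    (hs : ∀ i, MemLp (fun ω => s ω i) 2 μ)
    (hsS : ∀ i ∉ S, ∀ᵐ ω ∂μ, s ω i = 0)
    (hB : ∀ i j, ∫ ω, s ω i * star (s ω j) ∂μ = B i j) :
    Integrable (fun ω => txPower (Q ω) (s ω)) μ ∧
      ∫ ω, txPower (Q ω) (s ω) ∂μ = ∫ ω, trace (Q ω * B * (Q ω)ᴴ) ∂μ := by
  have key : ∀ a i j,
      Integrable (fun ω => (Q ω a i * star (Q ω a j)) * (s ω i * star (s ω j))) μ ∧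
      Integrable (fun ω => (Q ω a i * star (Q ω a j)) * B i j) μ ∧
      ∫ ω, (Q ω a i * star (Q ω a j)) * (s ω i * star (s ω j)) ∂μ =
        ∫ ω, (Q ω a i * star (Q ω a j)) * B i j ∂μ := by
    intro a i j
    by_cases hij : i ∈ S ∧ j ∈ S
    · have hQi : Integrable (fun ω => Q ω a i * star (Q ω a j)) μ :=
        (hQ a i hij.1).integrable_mul (hQ a j hij.2).star
      have hsi : Integrable (fun ω => s ω i * star (s ω j)) μ := (hs i).integrable_mul (hs j).star
      have hind' : IndepFun (fun ω => Q ω a i * star (Q ω a j)) (fun ω => s ω i * star (s ω j)) μ :=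
        hind.comp (φ := fun q : Fin n → Fin n → ℂ => q a i * star (q a j))
          (ψ := fun v : Fin n → ℂ => v i * star (v j))
          (Continuous.measurable (by fun_prop)) (Continuous.measurable (by fun_prop))
      refine ⟨hind'.integrable_mul hQi hsi, hQi.mul_const _, ?_⟩
      rw [hind'.integral_fun_mul_eq_mul_integral hQi.aestronglyMeasurable hsi.aestronglyMeasurable,
        hB, integral_mul_const]
    -- Off `S` both integrands vanish almost surely, so nothing is required of those columns of `Q`.
    · have hz : ∀ᵐ ω ∂μ, s ω i * star (s ω j) = 0 := by
        rcases not_and_or.1 hij with hi | hj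
        · filter_upwards [hsS i hi] with ω hω
          simp [hω]
        · filter_upwards [hsS j hj] with ω hω
          simp [hω]
      have hB0 : B i j = 0 := by rw [← hB, integral_congr_ae hz, integral_zero]
      have hz' : (fun ω => (Q ω a i * star (Q ω a j)) * (s ω i * star (s ω j))) =ᵐ[μ] 0 := by
        filter_upwards [hz] with ω hω
        rw [hω, mul_zero, Pi.zero_apply]
      refine ⟨(integrable_zero _ _ _).congr hz'.symm, ?_, ?_⟩
      · simp [hB0]
      · rw [integral_congr_ae hz']
        simp [hB0]
  simp_rw [txPower_eq_sum, trace_mul_mul_conjTranspose_eq_sum]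
  refine ⟨integrable_finsetSum _ fun a _ => integrable_finsetSum _ fun i _ =>
    integrable_finsetSum _ fun j _ => (key a i j).1, ?_⟩
  rw [integral_finsetSum _ fun a _ => integrable_finsetSum _ fun i _ =>
      integrable_finsetSum _ fun j _ => (key a i j).1,
    integral_finsetSum _ fun a _ => integrable_finsetSum _ fun i _ =>
      integrable_finsetSum _ fun j _ => (key a i j).2.1]
  refine Finset.sum_congr rfl fun a _ => ?_
  rw [integral_finsetSum _ fun i _ => integrable_finsetSum _ fun j _ => (key a i j).1,
    integral_finsetSum _ fun i _ => integrable_finsetSum _ fun j _ => (key a i j).2.1]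
  refine Finset.sum_congr rfl fun i _ => ?_
  rw [integral_finsetSum _ fun j _ => (key a i j).1,
    integral_finsetSum _ fun j _ => (key a i j).2.1]
  exact Finset.sum_congr rfl fun j _ => (key a i j).2.2

theorem ae_eq_zero_of_integral_mul_star_eq_zero {f : Ω → ℂ} (hf : MemLp f 2 μ)
    (h : ∫ ω, f ω * star (f ω) ∂μ = 0) : ∀ᵐ ω ∂μ, f ω = 0 := by
  have e : ∀ z : ℂ, z * star z = ((‖z‖ ^ 2 : ℝ) : ℂ) := fun z => by
    simp [Complex.mul_conj, Complex.normSq_eq_norm_sq]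
  simp_rw [e] at h
  rw [integral_complex_ofReal, Complex.ofReal_eq_zero,
    integral_eq_zero_iff_of_nonneg (fun _ => by positivity) 
      ((memLp_two_iff_integrable_sq_norm hf.aestronglyMeasurable).1 hf)] at h
  filter_upwards [h] with ω hω
  simpa using hω

end SignalPower

/-- The trace is the sum of the squared moduli of all entries in the columns indexed by `S`. -/
theorem sq_norm_apply_le_norm_trace {n : ℕ} (Q : Matrix (Fin n) (Fin n) ℂ) {S : Set (Fin n)}
    (a : Fin n) {i : Fin n} (hi : i ∈ S) :
    ‖Q a i‖ ^ 2 ≤ ‖trace (Q * diagonal (S.indicator 1) * Qᴴ)‖ := by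
  have e : trace (Q * diagonal (S.indicator 1) * Qᴴ) =
      ((∑ a, ∑ i, S.indicator (fun i => ‖Q a i‖ ^ 2) i : ℝ) : ℂ) := by
    rw [trace_mul_mul_conjTranspose_eq_sum]
    push_cast
    refine Finset.sum_congr rfl fun a _ => Finset.sum_congr rfl fun i _ => ?_
    rw [Finset.sum_eq_single i (fun j _ hj => by rw [diagonal_apply_ne' _ hj, mul_zero]) (by simp)]
    by_cases hi : i ∈ S <;> simp [hi, Complex.mul_conj, Complex.normSq_eq_norm_sq]
  have h0 : ∀ a i, 0 ≤ S.indicator (fun i => ‖Q a i‖ ^ 2) i := fun a i =>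
    Set.indicator_nonneg (fun _ _ => by positivity) i
  rw [e, Complex.norm_real]
  calc ‖Q a i‖ ^ 2 = S.indicator (fun i => ‖Q a i‖ ^ 2) i := by simp [hi]
    _ ≤ ∑ i, S.indicator (fun i => ‖Q a i‖ ^ 2) i :=
        Finset.single_le_sum (fun i _ => h0 a i) (Finset.mem_univ i)
    _ ≤ ∑ a, ∑ i, S.indicator (fun i => ‖Q a i‖ ^ 2) i :=
        Finset.single_le_sum (f := fun a => ∑ i, S.indicator (fun i => ‖Q a i‖ ^ 2) i)
          (fun a _ => Finset.sum_nonneg fun i _ => h0 a i) (Finset.mem_univ a)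
    _ ≤ _ := Real.le_norm_self _

theorem matB_eq_diagonal {m n : ℕ} (h : 2 * m < n) : matB h =
    diagonal ({i | ∀ k, (blk h).symm i ≠ Sum.inl (Sum.inr k)}.indicator 1) := by
  ext i j
  obtain ⟨i, rfl⟩ := (blk h).surjective i
  obtain ⟨j, rfl⟩ := (blk h).surjective j
  rcases i with (i | i) | i <;> rcases j with (j | j) | j <;>
    simp [matB, ofBlks, diagonal_apply, one_apply]

/-! ### Assembly. -/

theorem theorem3 {Ω : Type*} [MeasurableSpace Ω] (μ : Measure Ω) [IsProbabilityMeasure μ]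
    (m n : ℕ) (hm : 0 < m) (h : 2 * m < n) (η : ℝ) (hη : η = (m : ℝ) / (n : ℝ))
    (H₁ H₂ : Ω → Matrix (Fin m) (Fin n) ℂ) (hH : IsGaussianPair μ H₁ H₂) :
    -- the trace identity, for every outcome of the construction on arbitrary matrices
    (∀ (A₁ A₂ : Matrix (Fin m) (Fin n) ℂ) (U V : Matrix (Fin m) (Fin m) ℂ)
        (Q : Matrix (Fin n) (Fin n) ℂ), IsZhaGSVD h A₁ A₂ U V Q →
      IsGSVD h A₁ A₂ U V Q ∧
      IsUnit (stacked A₁ A₂ * (stacked A₁ A₂)ᴴ).det ∧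
      trace (Q * matB h * Qᴴ) = trace ((stacked A₁ A₂ * (stacked A₁ A₂)ᴴ)⁻¹)) ∧
    -- almost surely, the construction can be carried out
    (∀ᵐ ω ∂μ, ∃ (U V : Matrix (Fin m) (Fin m) ℂ) (Q : Matrix (Fin n) (Fin n) ℂ),
      IsZhaGSVD h (H₁ ω) (H₂ ω) U V Q) ∧
    -- `E[tr((H Hᴴ)⁻¹)] = 1 / (1 / (2η) - 1)`
    Integrable (fun ω => trace ((stacked (H₁ ω) (H₂ ω) * (stacked (H₁ ω) (H₂ ω))ᴴ)⁻¹)) μ ∧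
    ∫ ω, trace ((stacked (H₁ ω) (H₂ ω) * (stacked (H₁ ω) (H₂ ω))ᴴ)⁻¹) ∂μ
      = ((1 / (1 / (2 * η) - 1) : ℝ) : ℂ) ∧
    ∀ Q : Ω → Matrix (Fin n) (Fin n) ℂ,
      (∀ᵐ ω ∂μ, ∃ U V : Matrix (Fin m) (Fin m) ℂ, IsZhaGSVD h (H₁ ω) (H₂ ω) U V (Q ω)) →
      -- `E[tr(Q B Qᴴ)] = E[tr((H Hᴴ)⁻¹)]`
      Integrable (fun ω => trace (Q ω * matB h * (Q ω)ᴴ)) μ ∧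
      ∫ ω, trace (Q ω * matB h * (Q ω)ᴴ) ∂μ
        = ∫ ω, trace ((stacked (H₁ ω) (H₂ ω) * (stacked (H₁ ω) (H₂ ω))ᴴ)⁻¹) ∂μ ∧
      -- `t² = E[tr(Q s sᴴ Qᴴ)] = E[tr(Q B Qᴴ)]`, for a random signal vector `s`
      -- independent of `Q` with `E[s sᴴ] = B`
      ∀ s : Ω → Fin n → ℂ, (∀ i j, AEMeasurable (fun ω => Q ω i j) μ) →
        IndepFun (fun ω i j => Q ω i j) s μ →
        (∀ i, MemLp (fun ω => s ω i) 2 μ) →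
        (∀ i j, ∫ ω, s ω i * star (s ω j) ∂μ = matB h i j) →
        Integrable (fun ω => txPower (Q ω) (s ω)) μ ∧
        ∫ ω, txPower (Q ω) (s ω) ∂μ = ∫ ω, trace (Q ω * matB h * (Q ω)ᴴ) ∂μ := by
  have hn : 0 < n := by omega
  have hcard : Fintype.card (Fin m ⊕ Fin m) < Fintype.card (Fin n) := by simp; omega
  have hlaw := hH.hasLaw_stacked
  have hdet : ∀ (A₁ A₂ : Matrix (Fin m) (Fin n) ℂ) (U V : Matrix (Fin m) (Fin m) ℂ)
      (Q : Matrix (Fin n) (Fin n) ℂ), IsZhaGSVD h A₁ A₂ U V Q →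
      IsGSVD h A₁ A₂ U V Q ∧
      IsUnit (stacked A₁ A₂ * (stacked A₁ A₂)ᴴ).det ∧
      trace (Q * matB h * Qᴴ) = trace ((stacked A₁ A₂ * (stacked A₁ A₂)ᴴ)⁻¹) :=
    fun A₁ A₂ U V Q hZ => ⟨hZ.isGSVD.1, hZ.isGSVD.1.trace_eq_of_commute hZ.isGSVD.2⟩
  have hexists : ∀ᵐ ω ∂μ, ∃ (U V : Matrix (Fin m) (Fin m) ℂ) (Q : Matrix (Fin n) (Fin n) ℂ),
      IsZhaGSVD h (H₁ ω) (H₂ ω) U V Q := by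
    have hli := ae_linearIndependent_stdComplexGaussianMatrix hcard.le
    rw [← hlaw.map_eq] at hli
    filter_upwards [ae_of_ae_map hlaw.aemeasurable hli] with ω hω
    open scoped ComplexOrder in
    exact exists_isZhaGSVD h (PosDef.mul_conjTranspose_self _ (vecMul_injective_iff.2 hω))
  have hint : Integrable
      (fun ω => trace ((stacked (H₁ ω) (H₂ ω) * (stacked (H₁ ω) (H₂ ω))ᴴ)⁻¹)) μ := by
    have := integrable_trace_inv_gram hcard
    rw [← hlaw.map_eq] at this
    exact this.comp_aemeasurable hlaw.aemeasurable
  refine ⟨hdet, hexists, hint, ?_, fun Q hQ => ?_⟩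
  · have h1 := integral_trace_inv_gram hcard
    have h2 := (integrable_trace_inv_gram hcard).aestronglyMeasurable
    rw [← hlaw.map_eq] at h1 h2
    rw [integral_map hlaw.aemeasurable h2] at h1
    refine h1.trans ?_
    congr 1
    have hm' : (m : ℝ) ≠ 0 := by exact_mod_cast hm.ne'
    have hn' : (n : ℝ) ≠ 0 := by exact_mod_cast hn.ne'
    have hmn : (n : ℝ) - 2 * m ≠ 0 := by
      have : (2 * m : ℝ) < n := by exact_mod_cast h
      linarith
    have e : 1 / (2 * ((m : ℝ) / n)) - 1 = (n - 2 * m) / (2 * m) := by field_simp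
    rw [hη, e, one_div_div]
    simp only [Fintype.card_sum, Fintype.card_fin]
    push_cast
    rw [← two_mul, div_eq_mul_inv]
  -- The trace identity transfers integrability from `H` to `Q` without any measurability of `Q`.
  have hae : (fun ω => trace (Q ω * matB h * (Q ω)ᴴ)) =ᵐ[μ]
      fun ω => trace ((stacked (H₁ ω) (H₂ ω) * (stacked (H₁ ω) (H₂ ω))ᴴ)⁻¹) := by
    filter_upwards [hQ] with ω ⟨U, V, hZ⟩
    exact (hdet _ _ _ _ _ hZ).2.2
  have hintQ := hint.congr hae.symm
  refine ⟨hintQ, integral_congr_ae hae, fun s hQm hind hs hsB => ?_⟩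
  refine integral_txPower (S := {i | ∀ k, (blk h).symm i ≠ Sum.inl (Sum.inr k)}) ?_ hind hs ?_ hsB
  · intro a i hi
    rw [memLp_two_iff_integrable_sq_norm (hQm a i).aestronglyMeasurable]
    refine hintQ.norm.mono' ((hQm a i).norm.pow_const 2).aestronglyMeasurable
      (Filter.Eventually.of_forall fun ω => ?_)
    rw [Real.norm_of_nonneg (by positivity), matB_eq_diagonal]
    exact sq_norm_apply_le_norm_trace (Q ω) a hi
  -- A middle index has `E|s i|² = B i i = 0`.
  · intro i hi
    refine ae_eq_zero_of_integral_mul_star_eq_zero (hs i) ?_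
    rw [hsB]
    rw [matB_eq_diagonal, diagonal_apply_eq, Set.indicator_of_notMem hi]
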